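/- **Setting.** Let $X$ be an open subset (coordinate domain) of a finite-dimensional real affine space with vector space $V$, let $(T,\eta)$ be a Euclidean vector space with $\dim T=\dim V$, and let $e_x=k_x\cdot\partial_x$ be a frame field on $X$, given by linear isomorphisms $k_x:T\to V$ that depend smoothly on $x\in X$. It is orthonormal for the metric $g_x(u,u)=\eta(h_xu,h_xu)$, $h_x=k_x^{-1}$. All groups are local. A *deformed translation group* is given by smooth maps $K_x:T\to V$ with smooth inverses $H_x$, $K_x(0)=0$, defined on open neighbourhoods of the zero section. It acts by $f_x(t)=x+K_x(t)$ and has the multiplication law $\varphi_x(t,t')=H_x(K_x(t)+K_{x'}(t'))$, $x'=f_x(t)$. Its frame is given by $\partial K_x(0)$ and its connection by $\gamma_x=\partial_t\partial_{t'}\varphi_x(0,0)$. It is *canonical* if any two points $x,x'$ (with $x'$ in reach of the local group at $x$) lie on a smooth curve $s\mapsto x(s)$, $x(0)=x$, with $x(s)=f_x(s\tau_x)$ and $\varphi_x(s\tau_x,s'\tau_{x(s)})=(s+s')\tau_x$ whenever this product is defined, where $\tau_{x(s)}=h_{x(s)}\dot x(s)$. It is a *group of Riemannian translations* $RT$ if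 moreover $\eta(\tau_{x(s)},\tau_{x(s)})$ is constant along these curves. A *deformed motion group* consists of a deformed translation group and isometries $\pi_x(t)$ of $(T,\eta)$, smooth in $(x,t)$, with $\pi_x(0)=1$; its multiplication law on pairs $(t,r)$, where $r$ is an isometry of $(T,\eta)$, is $$\Phi_x\big((t,r),(t',r')\big)=\big(\varphi_x(t,t'),\ r\,\pi_x(t)\,r'\,\pi_{x'}(t')\,\pi_x(\varphi_x(t,t'))^{-1}\big).$$ It is a group $DR$ over an $RT$ if it has the same frame and if $\partial\pi_x(0)=\gamma_x$, the connection of $RT$. It is a *group of parallel transports* $DP$ over $RT$ if it is a $DR$, if the action of its translation part on $X$ defines the same connection $\gamma_x$, and if any two points $x,x'$ as above lie on a smooth curve with $x(s)=f_x(s\tau_x)$ and $\Phi_x((s\tau_x,1),(s'\tau_{x(s)},1))=((s+s')\tau_x,1)$ whenever this product is defined. **Proposition 4.** For a given frame field $e_x$, the group of parallel transports is uniquely determined: there are a group $RT$ with frame field $e_x$ and a group $DP$ over it, and any two such groups $DP$ (over any two groups $RT$ with frame field $e_x$) have the same maps $K_x$, $H_x$, $\pi_x$ and the same multiplication law wherever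 both are defined. Moreover, for every such pair $RT$, $DP$: 1. the translation part of $DP$ coincides with $RT$ (wherever both are defined); 2. $\gamma_x$ is the Levi-Civita connection of $g$ in the frame $e_x$, that is, $\eta\langle\tau,\gamma_x\langle t,\tau'\rangle\rangle=\frac12(\eta\langle t,C_x\langle\tau,\tau'\rangle\rangle+\eta\langle\tau,C_x\langle t,\tau'\rangle\rangle-\eta\langle\tau',C_x\langle t,\tau\rangle\rangle)$ with $C_x$ the anholonomity object of $e_x$; 3. $\pi_x$ is the finite parallel transport along geodesics: for $t$ in the domain at $x$, the curve $x(s)=f_x(st)$, $s\in[0,1]$, is the geodesic with $\dot x=k_x\langle\tau\rangle$, $\dot\tau=-\gamma_x\langle\tau,\tau\rangle$, $\tau(0)=t$, and a curve $\theta(s)$ in $T$ solves $\dot\theta=-\gamma_{x(s)}\langle\tau(s),\theta\rangle$ on $[0,1]$ if and only if $\pi_x(st)\langle\theta(s)\rangle=\theta(0)$ for all $s\in[0,1]$; 4. for every $x\in X$, $\pi_x$ is, among the differentiable maps $\varpi$ from the domain at $x$ to the linear endomorphisms of $T$, the unique solution of $\varpi(0)=1$ and $$\partial_{x'}\big[\varpi(H_x(x'-x))\big]\langle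 k_{x'}\tau_{x'}\rangle\,\theta=\varpi(H_x(x'-x))\langle\gamma_{x'}\langle\tau_{x'},\theta\rangle\rangle\quad\text{for all }\theta\in T,$$ at every $x'=f_x(t)$, where $\tau_{x'}$ is the velocity at $x'$, in the frame, of the curve $s\mapsto f_x(st)$. -/

import Mathlib

open scoped ContDiff

section

variable {V : Type*} [NormedAddCommGroup V] [NormedSpace ℝ V]
variable {T : Type*} [NormedAddCommGroup T] [InnerProductSpace ℝ T]

/-- A local deformed gauge translation group on a coordinate domain `X` of the affine space `V`,
with parameters in the Euclidean space `T`. The deformation map `H x` and its inverse `K x` are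
local: `K x` is defined on the fibre of `dom` over `x`, `H x` on the fibre of `rng` over `x`. -/
structure TranslationGroup (X : Set V) (T : Type*) [NormedAddCommGroup T]
    [InnerProductSpace ℝ T] where
  /-- the inverse deformation map `K_x` -/
  K : V → T → V
  /-- the deformation map `H_x` -/
  H : V → V → T
  /-- pairs `(x, t)` such that `K_x(t)` is defined -/
  dom : Set (V × T)
  /-- pairs `(x, u)` such that `H_x(u)` is defined -/
  rng : Set (V × V)
  isOpen_dom : IsOpen dom
  isOpen_rng : IsOpen rng
  zero_mem : ∀ x ∈ X, (x, (0 : T)) ∈ dom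
  K_zero : ∀ x ∈ X, K x 0 = 0
  base_mem : ∀ x t, (x, t) ∈ dom → x ∈ X
  target_mem : ∀ x t, (x, t) ∈ dom → x + K x t ∈ X
  K_mem : ∀ x t, (x, t) ∈ dom → (x, K x t) ∈ rng
  H_mem : ∀ x u, (x, u) ∈ rng → (x, H x u) ∈ dom
  H_K : ∀ x t, (x, t) ∈ dom → H x (K x t) = t
  K_H : ∀ x u, (x, u) ∈ rng → K x (H x u) = u
  smooth_K : ContDiffOn ℝ ∞ (fun p : V × T => K p.1 p.2) dom
  smooth_H : ContDiffOn ℝ ∞ (fun p : V × V => H p.1 p.2) rng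

namespace TranslationGroup

variable {X : Set V}

/-- The action on the base: `f_x(t) = x + K_x(t)`. -/
def act (G : TranslationGroup X T) (x : V) (t : T) : V := x + G.K x t

/-- The multiplication law `φ_x(t, t') = H_x(K_x(t) + K_{x'}(t'))`, where `x' = f_x(t)`. -/
def mul (G : TranslationGroup X T) (x : V) (t t' : T) : T :=
  G.H x (G.K x t + G.K (G.act x t) t')

/-- The product `φ_x(t, t')` is defined in the local group. -/
def MulDefined (G : TranslationGroup X T) (x : V) (t t' : T) : Prop :=
  (x, t) ∈ G.dom ∧ (G.act x t, t') ∈ G.dom ∧ (x, G.K x t + G.K (G.act x t) t') ∈ G.rng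

/-- The deformation coefficients `k_x = ∂K_x(0)`; the generators of the action are
`e_x = k_x · ∂_x`. -/
noncomputable def coeff (G : TranslationGroup X T) (x : V) : T →L[ℝ] V := fderiv ℝ (G.K x) 0

/-- `h_x = ∂H_x(0)`, the inverse of `k_x`. -/
noncomputable def coframe (G : TranslationGroup X T) (x : V) : V →L[ℝ] T := fderiv ℝ (G.H x) 0

/-- `γ_x⟨l, l'⟩`, where `γ_x = ∂∂'φ_x(0, 0)`: the connection which the group defines on `X`, in the
frame `e_x`. -/
noncomputable def gamma (G : TranslationGroup X T) (x : V) (l l' : T) : T :=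
  fderiv ℝ (fun t => fderiv ℝ (fun t' => G.mul x t t') 0 l') 0 l

/-- The components `τ = h_{c(s)}⟨ċ(s)⟩` of the velocity of a curve `c` in the frame. -/
noncomputable def velocity (G : TranslationGroup X T) (c : ℝ → V) (s : ℝ) : T :=
  G.coframe (c s) (deriv c s)

/-- `c`, on the open interval `(a, b)` around `0`, is a smooth curve from `x` such that
`x' = c(s)` is the image of `x` under `sτ_x` and `φ_x(sτ_x, s'τ_{x'}) = (s + s')τ_x`, whenever this
product is defined. -/
structure IsCanonicalCurve (G : TranslationGroup X T) (x : V) (c : ℝ → V) (a b : ℝ) : Prop where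
  neg : a < 0
  pos : 0 < b
  smooth : ContDiffOn ℝ ∞ c (Set.Ioo a b)
  start : c 0 = x
  mem : ∀ s ∈ Set.Ioo a b, (x, s • G.velocity c 0) ∈ G.dom
  act_eq : ∀ s ∈ Set.Ioo a b, G.act x (s • G.velocity c 0) = c s
  mul_eq : ∀ s s' : ℝ, s ∈ Set.Ioo a b → s + s' ∈ Set.Ioo a b →
    G.MulDefined x (s • G.velocity c 0) (s' • G.velocity c s) →
    G.mul x (s • G.velocity c 0) (s' • G.velocity c s) = (s + s') • G.velocity c 0

/-- Canonical group: any two points `x, x'` (with `x'` within the reach of the local group at `x`)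
lie on a curve with the property above. -/
def IsCanonical (G : TranslationGroup X T) : Prop :=
  ∀ x x' : V, (x, x' - x) ∈ G.rng →
    ∃ (c : ℝ → V) (a b S : ℝ), G.IsCanonicalCurve x c a b ∧ S ∈ Set.Ioo a b ∧ c S = x'

/-- Group of Riemannian translations: a canonical group for which the length of the unit of scale is
preserved when it is transported along itself, `η⟨τ_x, τ_x⟩ = η⟨τ_{x'}, τ_{x'}⟩`. -/
structure IsRiemannian (G : TranslationGroup X T) : Prop where
  canonical : G.IsCanonical
  length : ∀ (x : V) (c : ℝ → V) (a b : ℝ), x ∈ X → G.IsCanonicalCurve x c a b →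
    ∀ s ∈ Set.Ioo a b, inner ℝ (G.velocity c s) (G.velocity c s) =
      inner ℝ (G.velocity c 0) (G.velocity c 0)

/-- The frame field of the group is `e_x = k_x · ∂_x`. -/
def HasFrame (G : TranslationGroup X T) (k : V → T ≃L[ℝ] V) : Prop :=
  ∀ x ∈ X, G.coeff x = (k x : T →L[ℝ] V)

/-- Two local translation groups coincide: their deformation maps and their multiplication laws are
the same wherever both are defined. -/
structure Coincide (G G' : TranslationGroup X T) : Prop where
  K_eq : ∀ x t, (x, t) ∈ G.dom → (x, t) ∈ G'.dom → G.K x t = G'.K x t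
  H_eq : ∀ x u, (x, u) ∈ G.rng → (x, G.H x u) ∈ G'.dom →
    (x, u) ∈ G'.rng ∧ G.H x u = G'.H x u
  mul_eq : ∀ x t t', G.MulDefined x t t' → (x, t) ∈ G'.dom → (G.act x t, t') ∈ G'.dom →
    (x, G.mul x t t') ∈ G'.dom → G'.MulDefined x t t' ∧ G.mul x t t' = G'.mul x t t'

end TranslationGroup

/-- A local deformed group of motions of vectors: a deformation of the semidirect product of the
gauge translations and the gauge rotations (with values in the isometries of `T`), by a deformation
of the translations and by rotations `π_x(t)` with `π_x(0) = 1`. -/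
structure MotionGroup (X : Set V) (T : Type*) [NormedAddCommGroup T] [InnerProductSpace ℝ T]
    extends TranslationGroup X T where
  /-- the rotation `π_x(t)` -/
  rot : V → T → (T ≃ₗᵢ[ℝ] T)
  rot_zero : ∀ x ∈ X, rot x 0 = 1
  smooth_rot : ContDiffOn ℝ ∞
    (fun p : V × T => ((rot p.1 p.2).toContinuousLinearEquiv : T →L[ℝ] T)) dom

namespace MotionGroup

variable {X : Set V}

/-- The rotation `π_x(t)` as a linear map. -/
def rotL (P : MotionGroup X T) (x : V) (t : T) : T →L[ℝ] T :=
  ((P.rot x t).toContinuousLinearEquiv : T →L[ℝ] T)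

/-- The multiplication law of the group on the values `ϑ = (t, r)` of the parameter fields at `x`
and `ϑ' = (t', r')` at `x'`. With `x' = f_x(t)`,
`Φ_x(ϑ, ϑ') = (φ_x(t, t'), r ∘ π_x(t) ∘ r' ∘ π_{x'}(t') ∘ π_x(φ_x(t, t'))⁻¹)`. -/
def motionMul (P : MotionGroup X T) (x : V) (ϑ ϑ' : T × (T ≃ₗᵢ[ℝ] T)) : T × (T ≃ₗᵢ[ℝ] T) :=
  (P.mul x ϑ.1 ϑ'.1,
    ϑ.2 * P.rot x ϑ.1 * ϑ'.2 * P.rot (P.act x ϑ.1) ϑ'.1 * (P.rot x (P.mul x ϑ.1 ϑ'.1))⁻¹)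

/-- Group of motions `DR` of the tangent bundle over the group of Riemannian translations `R`: the
consistency condition `ē_x = e_x`, `γ̄_x = γ_x` holds, where `γ̄_x = ∂π_x(0)`. -/
structure IsTangentMotion (R : TranslationGroup X T) (P : MotionGroup X T) : Prop where
  frame : ∀ x ∈ X, P.coeff x = R.coeff x
  connection : ∀ x ∈ X, ∀ l θ : T, fderiv ℝ (P.rotL x) 0 l θ = R.gamma x l θ

/-- The curves of the extended canonicity condition:
`((sτ, 1) × (s'τ, 1))_x = ((s + s')τ_x, 1)`, whenever this product is defined. -/
structure IsCanonicalCurve (P : MotionGroup X T) (x : V) (c : ℝ → V) (a b : ℝ) : Prop where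
  neg : a < 0
  pos : 0 < b
  smooth : ContDiffOn ℝ ∞ c (Set.Ioo a b)
  start : c 0 = x
  mem : ∀ s ∈ Set.Ioo a b, (x, s • P.velocity c 0) ∈ P.dom
  act_eq : ∀ s ∈ Set.Ioo a b, P.act x (s • P.velocity c 0) = c s
  mul_eq : ∀ s s' : ℝ, s ∈ Set.Ioo a b → s + s' ∈ Set.Ioo a b →
    P.MulDefined x (s • P.velocity c 0) (s' • P.velocity c s) →
    P.motionMul x (s • P.velocity c 0, 1) (s' • P.velocity c s, 1) =
      ((s + s') • P.velocity c 0, 1)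

/-- Group of parallel transports `DP` over the group of Riemannian translations `R`: a group `DR`
that satisfies the extended canonicity condition and whose action on `X` defines the same affine
connection as that of `R`. (By `frame`, the coframes of `P` and `R` are the same.) -/
structure IsParallelTransport (R : TranslationGroup X T) (P : MotionGroup X T) : Prop where
  motion : IsTangentMotion R P
  base_connection : ∀ x ∈ X, ∀ l l' : T, P.gamma x l l' = R.gamma x l l'
  canonical : ∀ x x' : V, (x, x' - x) ∈ P.rng →
    ∃ (c : ℝ → V) (a b S : ℝ), P.IsCanonicalCurve x c a b ∧ S ∈ Set.Ioo a b ∧ c S = x'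

/-- Two local groups of motions coincide: their deformation maps, their rotations and their
multiplication laws are the same wherever both are defined. -/
structure Coincide (P P' : MotionGroup X T) : Prop where
  translations : P.toTranslationGroup.Coincide P'.toTranslationGroup
  rot_eq : ∀ x t, (x, t) ∈ P.dom → (x, t) ∈ P'.dom → P.rot x t = P'.rot x t
  mul_eq : ∀ x ϑ ϑ', P.MulDefined x ϑ.1 ϑ'.1 → (x, ϑ.1) ∈ P'.dom →
    (P.act x ϑ.1, ϑ'.1) ∈ P'.dom → (x, P.mul x ϑ.1 ϑ'.1) ∈ P'.dom →
    P'.MulDefined x ϑ.1 ϑ'.1 ∧ P.motionMul x ϑ ϑ' = P'.motionMul x ϑ ϑ'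

/-- `τ_{x'} = h_{x'}⟨ẋ'⟩` at `x' = f_x(t)`, for the curve `s ↦ f_x(st)`. -/
noncomputable def endVelocity (P : MotionGroup X T) (x : V) (t : T) : T :=
  P.coframe (P.act x t) (fderiv ℝ (P.K x) t t)

/-- The first-order partial differential equation for `ϖ = π_x`, along the geodesics from `x`, at
`x' = f_x(t)`: the derivative of `ϖ(H_x(x' - x))⟨θ⟩` with respect to `x'` in the direction of
`k_{x'}⟨τ_{x'}⟩` is `ϖ(H_x(x' - x))⟨γ_{x'}⟨τ_{x'}, θ⟩⟩`, for all `θ`. -/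
def TransportEq (P : MotionGroup X T) (R : TranslationGroup X T) (x : V) (ϖ : T → T →L[ℝ] T)
    (t : T) : Prop :=
  ∀ θ : T,
    fderiv ℝ (fun y => ϖ (P.H x (y - x))) (P.act x t)
        (R.coeff (P.act x t) (P.endVelocity x t)) θ =
      ϖ t (R.gamma (P.act x t) (P.endVelocity x t) θ)

end MotionGroup

/-- The anholonomity object `C_x⟨l, l'⟩` of the frame field `e_x = k_x · ∂_x`. -/
noncomputable def anholonomity (k : V → T ≃L[ℝ] V) (x : V) (l l' : T) : T :=
  (k x).symm (fderiv ℝ (fun y => (k y : T →L[ℝ] V)) x (k x l) l' -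
    fderiv ℝ (fun y => (k y : T →L[ℝ] V)) x (k x l') l)

/-- `γ` is on `X` the Levi-Civita connection of the metric for which the frame field is orthonormal,
written in that frame (Ricci rotation coefficients). -/
def IsLeviCivita (X : Set V) (k : V → T ≃L[ℝ] V) (γ : V → T → T → T) : Prop :=
  ∀ x ∈ X, ∀ t τ τ' : T, inner ℝ τ (γ x t τ') =
    (1 / 2 : ℝ) * (inner ℝ t (anholonomity k x τ τ') + inner ℝ τ (anholonomity k x t τ')
      - inner ℝ τ' (anholonomity k x t τ))

end

/-! Uniqueness. Applying `K_x` to the law on a canonical curve `c` gives `c(s + s') = c(s) +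
K_{c(s)}(s'τ_{c(s)})`. Two derivatives at `s' = 0`, together with `k_x γ_x(l, l') = Dk_x(k_x l) l' -
D²K_x(0)(l, l')` (`frame_gamma`), turn this into `τ̇ = -γ(τ, τ)`. Since `D²K_x(0)` is symmetric, the
torsion of `γ` is the anholonomity. Since `γ = ∂π(0)` and `π` is isometric, `γ` is skew. Koszul's
formula then makes `γ` the Levi-Civita connection of the frame, so the rays `s ↦ f_x(st)` of both
`DP` and `RT` are geodesics. The rotation component of the extended law reads `π_x((s + s')τ_x) =
π_x(sτ_x) π_{c(s)}(s'τ_{c(s)})`; its derivative is `π' = πγ(τ)`, so `π⁻¹` is parallel transport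
along the ray. Uniqueness for these two differential equations yields the uniqueness of `DP` and
claims 1 and 3. Claim 4 is the same equation read radially.

Existence. `K_x(t) = exp_x(t) - x`, and `π_x(t)` is the inverse of the transport along the geodesic.
Geodesics and transports form the flow of one vector field on `V × T × End T`, with equilibria `(x,
0, 1)`. The linearization there squares to zero, so the inverse function theorem on continuous
curves gives a smooth flow for a fixed time (`exists_contDiffOn_flow`). The derivative of `(x, t) ↦
(x, exp_x(t) - x)` at `(x₀, 0)` is `(id, k_{x₀})`, which provides local inverses jointly smooth in
both variables; these glue over all `x₀`. The group law along geodesics is the flow property. The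
geodesic equation fixes the symmetric part of the connection of this group and the torsion fixes the
rest, so it is Levi-Civita. -/

set_option linter.unusedSectionVars false

universe u

/-! ### The Levi-Civita connection of an orthonormal frame (Koszul formula) -/

section LeviCivita

variable {V : Type*} [NormedAddCommGroup V] [NormedSpace ℝ V]
variable {T : Type*} [NormedAddCommGroup T] [InnerProductSpace ℝ T]

theorem anholonomity_add_left (k : V → T ≃L[ℝ] V) (x : V) (l₁ l₂ l' : T) :
    anholonomity k x (l₁ + l₂) l' = anholonomity k x l₁ l' + anholonomity k x l₂ l' := by
  simp only [anholonomity, map_add, map_sub, add_apply]; abel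

theorem anholonomity_smul_left (k : V → T ≃L[ℝ] V) (x : V) (a : ℝ) (l l' : T) :
    anholonomity k x (a • l) l' = a • anholonomity k x l l' := by
  simp only [anholonomity, map_smul, map_sub, smul_apply, smul_sub]

theorem anholonomity_swap (k : V → T ≃L[ℝ] V) (x : V) (l l' : T) :
    anholonomity k x l l' = -anholonomity k x l' l := by
  simp only [anholonomity, map_sub]; abel

theorem anholonomity_add_right (k : V → T ≃L[ℝ] V) (x : V) (l l₁ l₂ : T) :
    anholonomity k x l (l₁ + l₂) = anholonomity k x l l₁ + anholonomity k x l l₂ := by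
  simp only [anholonomity, map_add, map_sub, add_apply]; abel

theorem anholonomity_smul_right (k : V → T ≃L[ℝ] V) (x : V) (a : ℝ) (l l' : T) :
    anholonomity k x l (a • l') = a • anholonomity k x l l' := by
  simp only [anholonomity, map_smul, map_sub, smul_apply, smul_sub]

/-- A metric connection whose torsion vanishes is given by the Koszul formula. -/
theorem isLeviCivita_of_skew_of_torsion {X : Set V} {k : V → T ≃L[ℝ] V} {γ : V → T → T → T}
    (hskew : ∀ x ∈ X, ∀ t τ τ' : T, inner ℝ τ (γ x t τ') = -inner ℝ τ' (γ x t τ))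
    (htor : ∀ x ∈ X, ∀ l l' : T, γ x l l' - γ x l' l = anholonomity k x l l') :
    IsLeviCivita X k γ := by
  intro x hx t τ τ'
  simp only [← htor x hx, inner_sub_right]
  linarith [hskew x hx t τ τ', hskew x hx τ t τ', hskew x hx τ' t τ]

theorem IsLeviCivita.unique {X : Set V} {k : V → T ≃L[ℝ] V} {γ γ' : V → T → T → T}
    (h : IsLeviCivita X k γ) (h' : IsLeviCivita X k γ') {x : V} (hx : x ∈ X) (l l' : T) :
    γ x l l' = γ' x l l' :=
  ext_inner_left ℝ fun τ => by rw [h x hx, h' x hx]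

/-- Exchanging `τ` and `τ'` changes the sign of the right side of the Koszul formula, because the
anholonomity is antisymmetric. -/
theorem IsLeviCivita.skew {X : Set V} {k : V → T ≃L[ℝ] V} {γ : V → T → T → T}
    (h : IsLeviCivita X k γ) {x : V} (hx : x ∈ X) (t τ τ' : T) :
    inner ℝ τ (γ x t τ') = -inner ℝ τ' (γ x t τ) := by
  rw [h x hx, h x hx, anholonomity_swap k x τ' τ, inner_neg_right]; ring

theorem IsLeviCivita.torsion {X : Set V} {k : V → T ≃L[ℝ] V} {γ : V → T → T → T}
    (h : IsLeviCivita X k γ) {x : V} (hx : x ∈ X) (l l' : T) :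
    γ x l l' - γ x l' l = anholonomity k x l l' := by
  refine ext_inner_left ℝ fun τ => ?_
  rw [inner_sub_right, h x hx, h x hx, anholonomity_swap k x τ l, anholonomity_swap k x l' τ,
    anholonomity_swap k x l' l]
  simp only [inner_neg_right]; ring

variable [FiniteDimensional ℝ T]

/-- The Levi-Civita connection of the metric for which the frame is orthonormal, as a bilinear
map. -/
noncomputable def leviCivita (k : V → T ≃L[ℝ] V) (x : V) : T →L[ℝ] T →L[ℝ] T :=
  LinearMap.toContinuousLinearMap <|
    (LinearMap.toContinuousLinearMap : (T →ₗ[ℝ] T) ≃ₗ[ℝ] (T →L[ℝ] T)).toLinearMap ∘ₗ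
    LinearMap.mk₂ ℝ (fun l l' => ∑ i, ((1 / 2 : ℝ) *
      (inner ℝ l (anholonomity k x (stdOrthonormalBasis ℝ T i) l')
      + inner ℝ (stdOrthonormalBasis ℝ T i) (anholonomity k x l l')
      - inner ℝ l' (anholonomity k x l (stdOrthonormalBasis ℝ T i)))) • stdOrthonormalBasis ℝ T i)
      (fun l₁ l₂ l' => by
        rw [← Finset.sum_add_distrib]
        refine Finset.sum_congr rfl fun i _ => ?_
        rw [← add_smul]; congr 1
        simp only [anholonomity_add_left, inner_add_left, inner_add_right]; ring)
      (fun a l l' => by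
        rw [Finset.smul_sum]
        refine Finset.sum_congr rfl fun i _ => ?_
        rw [← mul_smul]; congr 1
        simp only [anholonomity_smul_left, real_inner_smul_left, real_inner_smul_right]; ring)
      (fun l l₁ l₂ => by
        rw [← Finset.sum_add_distrib]
        refine Finset.sum_congr rfl fun i _ => ?_
        rw [← add_smul]; congr 1
        simp only [anholonomity_add_right, inner_add_left, inner_add_right]; ring)
      (fun a l l' => by
        rw [Finset.smul_sum]
        refine Finset.sum_congr rfl fun i _ => ?_
        rw [← mul_smul]; congr 1
        simp only [anholonomity_smul_right, real_inner_smul_left, real_inner_smul_right]; ring)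

theorem leviCivita_apply (k : V → T ≃L[ℝ] V) (x : V) (l l' : T) :
    leviCivita k x l l' = ∑ i, ((1 / 2 : ℝ) *
      (inner ℝ l (anholonomity k x (stdOrthonormalBasis ℝ T i) l')
      + inner ℝ (stdOrthonormalBasis ℝ T i) (anholonomity k x l l')
      - inner ℝ l' (anholonomity k x l (stdOrthonormalBasis ℝ T i)))) •
        stdOrthonormalBasis ℝ T i := rfl

/-- The definition prescribes the components in an orthonormal basis; the general case follows
because the Koszul expression is linear in `τ`. -/
theorem isLeviCivita_leviCivita (X : Set V) (k : V → T ≃L[ℝ] V) :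
    IsLeviCivita X k (fun x l l' => leviCivita k x l l') := by
  intro x _ t τ τ'
  simp only [leviCivita_apply, inner_sum, real_inner_smul_right]
  set b := stdOrthonormalBasis ℝ T
  conv_rhs => rw [← b.sum_repr τ]
  have hτ : ∀ l, anholonomity k x (∑ i, b.repr τ i • b i) l
      = ∑ i, b.repr τ i • anholonomity k x (b i) l := by
    intro l
    let f : T →ₗ[ℝ] T := ⟨⟨fun y => anholonomity k x y l,
      fun y z => anholonomity_add_left k x y z l⟩, fun a y => anholonomity_smul_left k x a y l⟩
    exact (map_sum f _ _).trans (Finset.sum_congr rfl fun i _ => map_smul f _ _)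
  have hτ' : ∀ l, anholonomity k x l (∑ i, b.repr τ i • b i)
      = ∑ i, b.repr τ i • anholonomity k x l (b i) := by
    intro l
    rw [anholonomity_swap, hτ, ← Finset.sum_neg_distrib]
    exact Finset.sum_congr rfl fun i _ => by rw [anholonomity_swap k x l, smul_neg]
  rw [hτ, hτ']
  simp only [inner_sum, sum_inner, real_inner_smul_right, real_inner_smul_left]
  rw [← Finset.sum_add_distrib, ← Finset.sum_sub_distrib, Finset.mul_sum]
  refine Finset.sum_congr rfl fun i _ => ?_
  rw [b.repr_apply_apply, real_inner_comm τ]; ring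

variable {X : Set V} {k : V → T ≃L[ℝ] V}

theorem contDiffOn_frame_symm [FiniteDimensional ℝ V]
    (hk : ContDiffOn ℝ ∞ (fun x => (k x : T →L[ℝ] V)) X) :
    ContDiffOn ℝ ∞ (fun x => ((k x).symm : V →L[ℝ] T)) X := by
  intro x hx
  have h := (contDiffAt_map_inverse (n := ∞) (k x)).comp_contDiffWithinAt x (hk x hx)
  refine h.congr (fun y _ => ?_) ?_ <;> simp

theorem contDiffOn_anholonomity [FiniteDimensional ℝ V] (hX : IsOpen X)
    (hk : ContDiffOn ℝ ∞ (fun x => (k x : T →L[ℝ] V)) X) (l l' : T) :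
    ContDiffOn ℝ ∞ (fun x => anholonomity k x l l') X := by
  have hD : ContDiffOn ℝ ∞ (fderiv ℝ (fun y => (k y : T →L[ℝ] V))) X :=
    hk.fderiv_of_isOpen hX (by simp)
  have h1 : ∀ l, ContDiffOn ℝ ∞ (fun x => (k x : T →L[ℝ] V) l) X := fun l =>
    hk.clm_apply contDiffOn_const
  exact (contDiffOn_frame_symm hk).clm_apply
    (((hD.clm_apply (h1 l)).clm_apply contDiffOn_const).sub
      ((hD.clm_apply (h1 l')).clm_apply contDiffOn_const))

theorem contDiffOn_leviCivita [FiniteDimensional ℝ V] (hX : IsOpen X)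
    (hk : ContDiffOn ℝ ∞ (fun x => (k x : T →L[ℝ] V)) X) :
    ContDiffOn ℝ ∞ (leviCivita k) X := by
  refine contDiffOn_clm_apply.2 fun l => contDiffOn_clm_apply.2 fun l' => ?_
  simp only [leviCivita_apply]
  refine ContDiffOn.sum fun i _ => ContDiffOn.smul (contDiffOn_const.mul ?_) contDiffOn_const
  exact ((contDiffOn_const.inner ℝ (contDiffOn_anholonomity hX hk _ _)).add
    (contDiffOn_const.inner ℝ (contDiffOn_anholonomity hX hk _ _))).sub
    (contDiffOn_const.inner ℝ (contDiffOn_anholonomity hX hk _ _))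

end LeviCivita

/-! ### Uniqueness for vector fields, composition operators, inverse function theorem -/

section ODE

/-- Two integral curves of a `C¹` vector field on an open set, with the same initial value,
coincide. -/
theorem eqOn_Icc_of_integralCurves {E : Type*} [NormedAddCommGroup E] [NormedSpace ℝ E]
    {f : E → E} {Ω : Set E} (hΩ : IsOpen Ω) (hf : ContDiffOn ℝ 1 f Ω) {y₁ y₂ : ℝ → E} {a b : ℝ}
    (h₁ : ∀ s ∈ Set.Icc a b, y₁ s ∈ Ω ∧ HasDerivAt y₁ (f (y₁ s)) s)
    (h₂ : ∀ s ∈ Set.Icc a b, y₂ s ∈ Ω ∧ HasDerivAt y₂ (f (y₂ s)) s)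
    (h0 : y₁ a = y₂ a) : Set.EqOn y₁ y₂ (Set.Icc a b) := by
  have c₁ : ContinuousOn y₁ (Set.Icc a b) := fun s hs => (h₁ s hs).2.continuousAt.continuousWithinAt
  have c₂ : ContinuousOn y₂ (Set.Icc a b) := fun s hs => (h₂ s hs).2.continuousAt.continuousWithinAt
  -- A `C¹` field is only locally Lipschitz; the compact union of the two traces supplies a single
  -- Lipschitz constant.
  have hS : IsCompact (y₁ '' Set.Icc a b ∪ y₂ '' Set.Icc a b) :=
    (isCompact_Icc.image_of_continuousOn c₁).union (isCompact_Icc.image_of_continuousOn c₂)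
  have hSΩ : y₁ '' Set.Icc a b ∪ y₂ '' Set.Icc a b ⊆ Ω := by
    rintro _ (⟨s, hs, rfl⟩ | ⟨s, hs, rfl⟩)
    exacts [(h₁ s hs).1, (h₂ s hs).1]
  obtain ⟨K, hK⟩ := LocallyLipschitzOn.exists_lipschitzOnWith_of_compact (f := f) hS (by
    intro z hz
    obtain ⟨K, t, ht, h⟩ := (hf.contDiffAt (hΩ.mem_nhds (hSΩ hz))).exists_lipschitzOnWith
    exact ⟨K, t, mem_nhdsWithin_of_mem_nhds ht, h⟩)
  exact ODE_solution_unique_of_mem_Icc_right (v := fun _ => f) (fun _ _ => hK) c₁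
    (fun s hs => (h₁ s (Set.Ico_subset_Icc_self hs)).2.hasDerivWithinAt)
    (fun s hs => Or.inl ⟨s, Set.Ico_subset_Icc_self hs, rfl⟩) c₂
    (fun s hs => (h₂ s (Set.Ico_subset_Icc_self hs)).2.hasDerivWithinAt)
    (fun s hs => Or.inr ⟨s, Set.Ico_subset_Icc_self hs, rfl⟩) h0

/-- Pointwise application of a continuous family of linear maps to a continuous function. -/
noncomputable def ContinuousMap.pointwiseCLM (K E F : Type*) [TopologicalSpace K] [CompactSpace K]
    [NormedAddCommGroup E] [NormedSpace ℝ E] [NormedAddCommGroup F] [NormedSpace ℝ F] :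
    C(K, E →L[ℝ] F) →L[ℝ] C(K, E) →L[ℝ] C(K, F) :=
  LinearMap.mkContinuous₂
    (LinearMap.mk₂ ℝ (fun (A : C(K, E →L[ℝ] F)) (η : C(K, E)) =>
        (⟨fun s => A s (η s), by fun_prop⟩ : C(K, F)))
      (fun _ _ _ => by ext; simp) (fun _ _ _ => by ext; simp)
      (fun _ _ _ => by ext; simp) (fun _ _ _ => by ext; simp)) 1
    (fun A η => by
      rw [one_mul, ContinuousMap.norm_le _ (by positivity)]
      intro s
      exact ((A s).le_opNorm _).trans
        (mul_le_mul (A.norm_coe_le_norm s) (η.norm_coe_le_norm s) (by positivity) (by positivity)))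

/-- The mean value inequality is applied at each `s` on a ball about `γ s`. Its radius is uniform in
`s` because composition with `f'` is continuous on `C(K, E)`. -/
theorem ContinuousMap.hasFDerivAt_postcomp {K E F : Type*} [TopologicalSpace K] [CompactSpace K]
    [NormedAddCommGroup E] [NormedSpace ℝ E] [NormedAddCommGroup F] [NormedSpace ℝ F]
    {f : C(E, F)} {f' : C(E, E →L[ℝ] F)} (hf : ∀ x, HasFDerivAt f (f' x) x) (γ : C(K, E)) :
    HasFDerivAt (fun γ : C(K, E) => f.comp γ)
      (ContinuousMap.pointwiseCLM K E F (f'.comp γ)) γ := by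
  rw [hasFDerivAt_iff_isLittleO_nhds_zero, Asymptotics.isLittleO_iff]
  intro ε hε
  have hc : ContinuousAt (fun γ : C(K, E) => f'.comp γ) γ := f'.continuous_postcomp.continuousAt
  obtain ⟨δ, hδ, h⟩ := (Metric.continuousAt_iff
    (f := fun γ : C(K, E) => f'.comp γ)).1 hc ε hε
  filter_upwards [Metric.ball_mem_nhds (0 : C(K, E)) hδ] with η hη
  rw [mem_ball_zero_iff] at hη
  rw [ContinuousMap.norm_le _ (by positivity)]
  intro s
  have key : ∀ y ∈ Metric.ball (γ s) δ, ‖f' y - f' (γ s)‖ ≤ ε := by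
    intro y hy
    -- Translating the whole curve by a constant converts a statement about nearby curves into one
    -- about the nearby point `y`.
    have h1 := h (x := γ + ContinuousMap.const K (y - γ s)) (by
      rw [dist_eq_norm, add_sub_cancel_left]
      refine lt_of_le_of_lt ((ContinuousMap.norm_le _ (norm_nonneg (y - γ s))).2 fun _ => le_rfl) ?_
      rwa [← dist_eq_norm])
    have h2 := (ContinuousMap.dist_apply_le_dist s).trans h1.le
    simpa [dist_eq_norm] using h2
  have h3 := (convex_ball (γ s) δ).norm_image_sub_le_of_norm_hasFDerivWithin_le' (f := f)
    (fun y _ => (hf y).hasFDerivWithinAt) key (Metric.mem_ball_self hδ)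
    (show γ s + η s ∈ Metric.ball (γ s) δ by
      rw [mem_ball_iff_norm, add_sub_cancel_left]
      exact (η.norm_coe_le_norm s).trans_lt hη)
  rw [add_sub_cancel_left] at h3
  exact h3.trans (mul_le_mul_of_nonneg_left (η.norm_coe_le_norm s) hε.le)

/-- The target `F` varies in the induction, since the derivative of `f` takes values in `E →L[ℝ] F`;
the common universe keeps that space admissible. -/
theorem ContinuousMap.contDiff_postcomp_nat {K : Type*} [TopologicalSpace K] [CompactSpace K]
    {E : Type u} [NormedAddCommGroup E] [NormedSpace ℝ E] (n : ℕ) :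
    ∀ {F : Type u} [NormedAddCommGroup F] [NormedSpace ℝ F] (f : C(E, F)), ContDiff ℝ n f →
      ContDiff ℝ n (fun γ : C(K, E) => f.comp γ) := by
  induction n with
  | zero =>
    intro F _ _ f hf
    exact contDiff_zero.2 f.continuous_postcomp
  | succ n ih =>
    intro F _ _ f hf
    rw [Nat.cast_succ, contDiff_succ_iff_hasFDerivAt] at hf ⊢
    obtain ⟨f', hf', h⟩ := hf
    have h₁ := ih ⟨f', hf'.continuous⟩ hf'
    have h₂ := ContinuousLinearMap.contDiff (𝕜 := ℝ) (E := C(K, E →L[ℝ] F))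
      (F := C(K, E) →L[ℝ] C(K, F)) (n := n) (ContinuousMap.pointwiseCLM K E F)
    exact ⟨fun γ => ContinuousMap.pointwiseCLM K E F
        ((⟨f', hf'.continuous⟩ : C(E, E →L[ℝ] F)).comp γ), h₂.comp h₁,
      ContinuousMap.hasFDerivAt_postcomp (f' := ⟨f', hf'.continuous⟩) h⟩

/-- The composition operator of a smooth map is smooth on continuous functions. -/
theorem ContinuousMap.contDiff_postcomp {K : Type*} [TopologicalSpace K] [CompactSpace K]
    {E : Type u} [NormedAddCommGroup E] [NormedSpace ℝ E] (f : C(E, E)) (hf : ContDiff ℝ ∞ f) :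
    ContDiff ℝ ∞ (fun γ : C(K, E) => f.comp γ) :=
  contDiff_infty.2 fun n =>
    ContinuousMap.contDiff_postcomp_nat n f (hf.of_le (by exact_mod_cast le_top))

/-- A smooth map with invertible derivative at a point restricts to a diffeomorphism between open
sets. -/
theorem exists_openPartialHomeomorph_of_contDiffOn {E F : Type*} [NormedAddCommGroup E]
    [NormedSpace ℝ E] [CompleteSpace E] [NormedAddCommGroup F] [NormedSpace ℝ F]
    {f : E → F} {U : Set E} (hU : IsOpen U) (hf : ContDiffOn ℝ ∞ f U) {a : E} (ha : a ∈ U)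
    (f' : E ≃L[ℝ] F) (hf' : HasFDerivAt f (f' : E →L[ℝ] F) a) :
    ∃ e : OpenPartialHomeomorph E F, (∀ x, e x = f x) ∧ a ∈ e.source ∧ e.source ⊆ U ∧
      ContDiffOn ℝ ∞ e.symm e.target := by
  have hca : ContDiffAt ℝ ∞ f a := hf.contDiffAt (hU.mem_nhds ha)
  have hD : ContinuousOn (fderiv ℝ f) U := hf.continuousOn_fderiv_of_isOpen hU (by simp)
  -- Restricting to points with invertible derivative, an open condition, makes the inverse smooth
  -- on the whole target and not only near the image of `a`.
  let W : Set E := U ∩ fderiv ℝ f ⁻¹' Set.range ((↑) : (E ≃L[ℝ] F) → E →L[ℝ] F)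
  have hW : IsOpen W := hD.isOpen_inter_preimage hU ContinuousLinearEquiv.isOpen
  have haW : a ∈ W := ⟨ha, f', hf'.fderiv.symm⟩
  let e₀ := hca.toOpenPartialHomeomorph f hf' (by simp)
  let e := e₀.restrOpen W hW
  have he : ∀ x, e x = f x := fun x => rfl
  have hsrc : e.source = e₀.source ∩ W := rfl
  refine ⟨e, he, ⟨hca.mem_toOpenPartialHomeomorph_source hf' (by simp), haW⟩,
    fun x hx => hx.2.1, fun y hy => ContDiffAt.contDiffWithinAt ?_⟩
  have hx : e.symm y ∈ W := (e.map_target hy).2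
  obtain ⟨g, hg⟩ := hx.2
  have hcx : ContDiffAt ℝ ∞ f (e.symm y) := hf.contDiffAt (hU.mem_nhds hx.1)
  exact e.contDiffAt_symm hy (f₀' := g)
    (by rw [hg]; exact (hcx.differentiableAt (by simp)).hasFDerivAt) hcx

end ODE

/-! ### Smooth flow near a degenerate equilibrium -/

section Flow

theorem neg_two_le_two : (-2 : ℝ) ≤ 2 := by norm_num

/-- The primitive, vanishing at `0`, of a continuous function on `[-2, 2]`. -/
noncomputable def primitiveCLM (E : Type u) [NormedAddCommGroup E] [NormedSpace ℝ E] :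
    C(Set.Icc (-2 : ℝ) 2, E) →L[ℝ] C(Set.Icc (-2 : ℝ) 2, E) :=
  LinearMap.mkContinuous
    { toFun := fun γ => ⟨fun s => ∫ σ in (0 : ℝ)..s, Set.IccExtend neg_two_le_two γ σ,
        (intervalIntegral.continuous_primitive
          (fun a b => (γ.continuous.Icc_extend' (h := neg_two_le_two)).intervalIntegrable a b) 0).comp
          continuous_subtype_val⟩
      map_add' := fun γ η => by
        ext s
        exact intervalIntegral.integral_add (γ.continuous.Icc_extend'.intervalIntegrable _ _)
          (η.continuous.Icc_extend'.intervalIntegrable _ _)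
      map_smul' := fun a γ => by
        ext s
        exact intervalIntegral.integral_smul a (Set.IccExtend neg_two_le_two γ) } 2 (fun γ => by
      rw [ContinuousMap.norm_le _ (by positivity)]
      intro s
      have h := intervalIntegral.norm_integral_le_of_norm_le_const (a := (0 : ℝ)) (b := s)
        (f := Set.IccExtend neg_two_le_two γ) (C := ‖γ‖) (fun σ _ => γ.norm_coe_le_norm _)
      refine h.trans ?_
      rw [mul_comm]
      refine mul_le_mul_of_nonneg_right ?_ (norm_nonneg _)
      rw [sub_zero, abs_le]
      exact s.2)

/-- Cutting off with a bump function makes the field globally smooth, so that its composition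
operator is defined on all continuous curves. -/
theorem exists_contDiff_eventuallyEq {E F : Type*} [NormedAddCommGroup E] [NormedSpace ℝ E]
    [FiniteDimensional ℝ E] [NormedAddCommGroup F] [NormedSpace ℝ F] {f : E → F} {Ω : Set E}
    (hΩ : IsOpen Ω) (hf : ContDiffOn ℝ ∞ f Ω) {z₀ : E} (hz : z₀ ∈ Ω) :
    ∃ g : E → F, ContDiff ℝ ∞ g ∧ g =ᶠ[nhds z₀] f := by
  obtain ⟨r, hr, hrΩ⟩ := Metric.nhds_basis_closedBall.mem_iff.1 (hΩ.mem_nhds hz)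
  let φ : ContDiffBump z₀ := ⟨r / 2, r, by positivity, by linarith⟩
  refine ⟨fun z => φ z • f z, contDiff_iff_contDiffAt.2 fun z => ?_, ?_⟩
  · by_cases hzs : z ∈ tsupport fun z => φ z • f z
    swap
    · exact (contDiffAt_const (c := (0 : F))).congr_of_eventuallyEq
        (notMem_tsupport_iff_eventuallyEq.1 hzs)
    have : z ∈ Metric.closedBall z₀ r := by
      have h := closure_mono (Function.support_smul_subset_left (fun z => φ z) f) hzs
      have h2 : tsupport φ = Metric.closedBall z₀ φ.rOut := φ.tsupport_eq
      exact h2 ▸ h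
    exact φ.contDiffAt.smul (hf.contDiffAt (hΩ.mem_nhds (hrΩ this)))
  · filter_upwards [φ.eventuallyEq_one] with z hz
    simp [hz]

/-- Near an equilibrium at which the linearization squares to zero, a smooth vector field has a
smooth flow over the time interval `(-2, 2)`. -/
theorem exists_contDiffOn_flow {E : Type u} [NormedAddCommGroup E] [NormedSpace ℝ E]
    [FiniteDimensional ℝ E] {f : E → E} {Ω : Set E} (hΩ : IsOpen Ω) (hf : ContDiffOn ℝ ∞ f Ω)
    {z₀ : E} (hz : z₀ ∈ Ω) (h0 : f z₀ = 0) (hA : ∀ w, fderiv ℝ f z₀ (fderiv ℝ f z₀ w) = 0) :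
    ∃ U : Set E, IsOpen U ∧ z₀ ∈ U ∧ ∃ y : E → ℝ → E, ContDiffOn ℝ ∞ (fun z => y z 1) U ∧
      ∀ z ∈ U, y z 0 = z ∧
        ∀ s ∈ Set.Ioo (-2 : ℝ) 2, y z s ∈ Ω ∧ HasDerivAt (y z) (f (y z s)) s := by
  obtain ⟨g, hg, hgf⟩ := exists_contDiff_eventuallyEq hΩ hf hz
  obtain ⟨δ, hδ, hball⟩ := Metric.eventually_nhds_iff_ball.1 (hgf.and (hΩ.mem_nhds hz))
  have hA' : ∀ w, fderiv ℝ g z₀ (fderiv ℝ g z₀ w) = 0 := by rw [hgf.fderiv_eq]; exact hA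
  have h0' : g z₀ = 0 := by rw [hgf.eq_of_nhds, h0]
  let gc : C(E, E) := ⟨g, hg.continuous⟩
  let g' : C(E, E →L[ℝ] E) := ⟨fderiv ℝ g, hg.continuous_fderiv (by simp)⟩
  let I := Set.Icc (-2 : ℝ) 2
  let J := primitiveCLM E
  let c₀ : C(I, E) := ContinuousMap.const I z₀
  -- The integral equation for the solution starting at `z` is `Φ γ = const z`. Inverting `Φ` near
  -- the constant curve `z₀` gives the solution, smoothly in `z`.
  let Φ : C(I, E) → C(I, E) := fun γ => γ - J (gc.comp γ)
  have hcomp : ContDiff ℝ ∞ (fun γ : C(I, E) => gc.comp γ) := ContinuousMap.contDiff_postcomp gc hg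
  have hJ : ContDiff ℝ ∞ J :=
    ContinuousLinearMap.contDiff (𝕜 := ℝ) (E := C(I, E)) (F := C(I, E)) J
  have hΦ : ContDiff ℝ ∞ Φ := contDiff_id.sub (hJ.comp hcomp)
  let N : C(I, E) →L[ℝ] C(I, E) := J.comp (ContinuousMap.pointwiseCLM I E E (g'.comp c₀))
  have hNapp : ∀ η s, N η s = ∫ σ in (0 : ℝ)..s, fderiv ℝ g z₀ (Set.IccExtend neg_two_le_two η σ) :=
    fun η s => rfl
  -- Integration commutes with the linearization, whose square vanishes. So `N² = 0` and `1 + N`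
  -- inverts `1 - N`, with no smallness condition on the time interval.
  have hNN : ∀ η, N (N η) = 0 := by
    intro η
    ext s
    rw [hNapp]
    refine (intervalIntegral.integral_congr (g := fun _ => (0 : E)) fun σ _ => ?_).trans
      intervalIntegral.integral_zero
    change fderiv ℝ g z₀ (N η (Set.projIcc (-2) 2 _ σ)) = 0
    rw [hNapp, ← ContinuousLinearMap.intervalIntegral_comp_comm]
    · simp [hA']
    · exact ((fderiv ℝ g z₀).continuous.comp η.continuous.Icc_extend').intervalIntegrable _ _
  have hΦ' : HasFDerivAt Φ (ContinuousLinearMap.id ℝ _ - N) c₀ := by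
    have h1 := ContinuousMap.hasFDerivAt_postcomp (K := I) (f := gc) (f' := g')
      (fun x => (hg.differentiable (by simp) x).hasFDerivAt) c₀
    exact (hasFDerivAt_id _).sub (J.hasFDerivAt.comp c₀ h1)
  let L : C(I, E) ≃L[ℝ] C(I, E) := ContinuousLinearEquiv.equivOfInverse
    (ContinuousLinearMap.id ℝ _ - N) (ContinuousLinearMap.id ℝ _ + N)
    (fun η => by simp [hNN]) (fun η => by simp [hNN])
  obtain ⟨e, he, hsrc, -, hsymm⟩ := exists_openPartialHomeomorph_of_contDiffOn isOpen_univ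
    hΦ.contDiffOn (Set.mem_univ c₀) L hΦ'
  have hΦ0 : Φ c₀ = c₀ := by
    have : gc.comp c₀ = 0 := by ext s; exact h0'
    simp [Φ, this]
  have htgt : c₀ ∈ e.target := by
    have h := e.map_source hsrc
    rwa [he, hΦ0] at h
  have hsymm0 : e.symm c₀ = c₀ := by
    have h := e.left_inv hsrc
    rwa [he, hΦ0] at h
  let κ : E →L[ℝ] C(I, E) := LinearMap.mkContinuous
    { toFun := fun z => ContinuousMap.const I z, map_add' := fun _ _ => rfl,
      map_smul' := fun _ _ => rfl } 1
    (fun z => by rw [one_mul]; exact (ContinuousMap.norm_le _ (norm_nonneg _)).2 fun _ => le_rfl)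
  -- Only solutions staying within `δ` of `z₀` are kept: there `g` agrees with `f` and the values
  -- lie in `Ω`.
  let S : Set C(I, E) := e.target ∩ e.symm ⁻¹' Metric.ball c₀ δ
  have hS : IsOpen S := e.symm.continuousOn.isOpen_inter_preimage e.open_target Metric.isOpen_ball
  have hU : IsOpen (κ ⁻¹' S) := hS.preimage κ.continuous
  have hκU : ∀ z ∈ κ ⁻¹' S, κ z ∈ e.target := fun z hz => hz.1
  -- The solution is given as an integral, which makes it a function on all of `ℝ`; it agrees with
  -- the fixed point on `[-2, 2]`.
  refine ⟨κ ⁻¹' S, hU, ⟨htgt, ?_⟩, fun z s => z + ∫ σ in (0 : ℝ)..s,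
    Set.IccExtend neg_two_le_two (gc.comp (e.symm (κ z))) σ, ?_, fun z hz => ?_⟩
  · change e.symm c₀ ∈ Metric.ball c₀ δ
    rw [hsymm0]; exact Metric.mem_ball_self hδ
  · have h1 : ContDiffOn ℝ ∞ (fun z => e.symm (κ z)) (κ ⁻¹' S) :=
      hsymm.comp κ.contDiff.contDiffOn hκU
    have h2 : ContDiffOn ℝ ∞ (fun z => J (gc.comp (e.symm (κ z)))) (κ ⁻¹' S) :=
      (hJ.comp hcomp).comp_contDiffOn h1
    have h3 : ContDiff ℝ ∞ (fun γ : C(I, E) => γ ⟨1, by norm_num, by norm_num⟩) :=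
      ContinuousLinearMap.contDiff (𝕜 := ℝ) (E := C(I, E)) (F := E)
        (ContinuousMap.evalCLM ℝ (⟨1, by norm_num, by norm_num⟩ : I))
    exact contDiffOn_id.add (h3.comp_contDiffOn h2)
  · have hfix : ∀ s (hs : s ∈ I), z + ∫ σ in (0 : ℝ)..s,
        Set.IccExtend neg_two_le_two (gc.comp (e.symm (κ z))) σ = e.symm (κ z) ⟨s, hs⟩ := by
      intro s hs
      have h := e.right_inv hz.1
      rw [he] at h
      have h2 : (e.symm (κ z) - J (gc.comp (e.symm (κ z)))) ⟨s, hs⟩ = κ z ⟨s, hs⟩ :=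
        congrArg (fun γ : C(I, E) => γ ⟨s, hs⟩) h
      rw [ContinuousMap.sub_apply, sub_eq_iff_eq_add] at h2
      exact h2.symm
    refine ⟨by simp, fun s hs => ?_⟩
    have hsI := Set.Ioo_subset_Icc_self hs
    have hmem : e.symm (κ z) ⟨s, hsI⟩ ∈ Metric.ball z₀ δ :=
      (ContinuousMap.dist_apply_le_dist (g := c₀) _).trans_lt hz.2
    have hd := intervalIntegral.integral_hasDerivAt_right
      (((gc.comp (e.symm (κ z))).continuous.Icc_extend'
        (h := neg_two_le_two)).intervalIntegrable 0 s)
      ((gc.comp (e.symm (κ z))).continuous.Icc_extend'.stronglyMeasurableAtFilter _ _)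
      ((gc.comp (e.symm (κ z))).continuous.Icc_extend'.continuousAt)
    rw [Set.IccExtend_of_mem _ _ hsI] at hd
    simp only [hfix s hsI]
    refine ⟨(hball _ hmem).2, ?_⟩
    rw [← (hball _ hmem).1]
    exact hd.const_add z

end Flow

/-! ### Differential calculus of a translation group and its canonical curves -/

section GroupCalculus

variable {V : Type*} [NormedAddCommGroup V] [NormedSpace ℝ V]
variable {T : Type*} [NormedAddCommGroup T] [InnerProductSpace ℝ T]
variable {X : Set V} {k : V → T ≃L[ℝ] V}

namespace TranslationGroup

variable {G : TranslationGroup X T}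

theorem eventually_mem_dom {x : V} {t : T} (h : (x, t) ∈ G.dom) :
    ∀ᶠ t' in nhds t, (x, t') ∈ G.dom :=
  (Continuous.prodMk_right x).continuousAt.preimage_mem_nhds (G.isOpen_dom.mem_nhds h)

theorem eventually_mem_rng {x u : V} (h : (x, u) ∈ G.rng) :
    ∀ᶠ u' in nhds u, (x, u') ∈ G.rng :=
  (Continuous.prodMk_right x).continuousAt.preimage_mem_nhds (G.isOpen_rng.mem_nhds h)

theorem contDiffAt_K {x : V} {t : T} (h : (x, t) ∈ G.dom) : ContDiffAt ℝ ∞ (G.K x) t :=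
  ContDiffAt.comp (g := fun p : V × T => G.K p.1 p.2) (f := fun t => (x, t)) t
    (G.smooth_K.contDiffAt (G.isOpen_dom.mem_nhds h)) (contDiffAt_const.prodMk contDiffAt_id)

theorem contDiffAt_H {x u : V} (h : (x, u) ∈ G.rng) : ContDiffAt ℝ ∞ (G.H x) u :=
  ContDiffAt.comp (g := fun p : V × V => G.H p.1 p.2) (f := fun t => (x, t)) u
    (G.smooth_H.contDiffAt (G.isOpen_rng.mem_nhds h)) (contDiffAt_const.prodMk contDiffAt_id)

theorem hasFDerivAt_K {x : V} {t : T} (h : (x, t) ∈ G.dom) :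
    HasFDerivAt (G.K x) (fderiv ℝ (G.K x) t) t :=
  ((contDiffAt_K h).differentiableAt (by simp)).hasFDerivAt

theorem hasFDerivAt_H {x u : V} (h : (x, u) ∈ G.rng) :
    HasFDerivAt (G.H x) (fderiv ℝ (G.H x) u) u :=
  ((contDiffAt_H h).differentiableAt (by simp)).hasFDerivAt

theorem fderiv_H_fderiv_K {x : V} {t : T} (h : (x, t) ∈ G.dom) (l : T) :
    fderiv ℝ (G.H x) (G.K x t) (fderiv ℝ (G.K x) t l) = l := by
  have h1 := (hasFDerivAt_H (G.K_mem x t h)).comp t (hasFDerivAt_K h)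
  have h2 : HasFDerivAt (G.H x ∘ G.K x) (ContinuousLinearMap.id ℝ T) t :=
    (hasFDerivAt_id t).congr_of_eventuallyEq
      ((eventually_mem_dom h).mono fun t' ht' => G.H_K x t' ht')
  exact congrArg (fun A : T →L[ℝ] T => A l) (h1.unique h2)

theorem fderiv_K_fderiv_H {x : V} {t : T} (h : (x, t) ∈ G.dom) (u : V) :
    fderiv ℝ (G.K x) t (fderiv ℝ (G.H x) (G.K x t) u) = u := by
  have h0 := hasFDerivAt_K h
  have h1 : HasFDerivAt (G.K x ∘ G.H x)
      ((fderiv ℝ (G.K x) t).comp (fderiv ℝ (G.H x) (G.K x t))) (G.K x t) :=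
    HasFDerivAt.comp (G.K x t) (by rw [G.H_K x t h]; exact h0) (hasFDerivAt_H (G.K_mem x t h))
  have h2 : HasFDerivAt (G.K x ∘ G.H x) (ContinuousLinearMap.id ℝ V) (G.K x t) :=
    (hasFDerivAt_id _).congr_of_eventuallyEq
      ((eventually_mem_rng (G.K_mem x t h)).mono fun t' ht' => G.K_H x t' ht')
  exact congrArg (fun A : V →L[ℝ] V => A u) (h1.unique h2)

theorem HasFrame.coframe_eq (hG : G.HasFrame k) {x : V} (hx : x ∈ X) (u : V) :
    G.coframe x u = (k x).symm u := by
  have h := fderiv_H_fderiv_K (G.zero_mem x hx) ((k x).symm u)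
  have h2 := hG x hx
  rw [coeff] at h2
  rw [h2, G.K_zero x hx] at h
  rw [coframe]
  simpa using h

theorem HasFrame.velocity_eq (hG : G.HasFrame k) {c : ℝ → V} {s : ℝ} (hx : c s ∈ X) :
    G.velocity c s = (k (c s)).symm (deriv c s) :=
  hG.coframe_eq hx _

theorem fderiv_mul_zero (hG : G.HasFrame k) {x : V} {t : T} (h : (x, t) ∈ G.dom) (l' : T) :
    fderiv ℝ (fun t' => G.mul x t t') 0 l'
      = fderiv ℝ (G.H x) (G.K x t) (k (x + G.K x t) l') := by
  have hx' := G.target_mem x t h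
  have h1 := hasFDerivAt_K (G.zero_mem _ hx')
  have h2 : HasFDerivAt (fun t' => G.K x t + G.K (x + G.K x t) t')
      (fderiv ℝ (G.K (x + G.K x t)) 0) 0 := h1.const_add _
  have h3 : HasFDerivAt (G.H x) (fderiv ℝ (G.H x) (G.K x t))
      (G.K x t + G.K (x + G.K x t) 0) := by
    rw [G.K_zero _ hx', add_zero]; exact hasFDerivAt_H (G.K_mem x t h)
  have h4 := (h3.comp (0 : T) h2).fderiv
  have h5 : fderiv ℝ (fun t' => G.mul x t t') 0 = (fderiv ℝ (G.H x) (G.K x t)).comp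
    (fderiv ℝ (G.K (x + G.K x t)) 0) := h4
  have h6 := hG _ hx'
  rw [coeff] at h6
  rw [h5, h6]; rfl

/-- The connection of a translation group in terms of the second derivative of its deformation
map. -/
theorem frame_gamma (hG : G.HasFrame k) (hX : IsOpen X)
    (hk : ContDiffOn ℝ ∞ (fun x => (k x : T →L[ℝ] V)) X) {x : V} (hx : x ∈ X) (l l' : T) :
    k x (G.gamma x l l') = fderiv ℝ (fun y => (k y : T →L[ℝ] V)) x (k x l) l'
      - fderiv ℝ (fderiv ℝ (G.K x)) 0 l l' := by
  have h0 := G.zero_mem x hx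
  have hK0 := G.K_zero x hx
  have hfr : fderiv ℝ (G.K x) 0 = (k x : T →L[ℝ] V) := hG x hx
  have hkx : HasFDerivAt (fun y => (k y : T →L[ℝ] V))
      (fderiv ℝ (fun y => (k y : T →L[ℝ] V)) x) (x + G.K x 0) := by
    rw [hK0, add_zero]
    exact ((hk.contDiffAt (hX.mem_nhds hx)).differentiableAt (by simp)).hasFDerivAt
  have hact : HasFDerivAt (fun t => x + G.K x t) (k x : T →L[ℝ] V) 0 := by
    rw [← hfr]; exact (hasFDerivAt_K h0).const_add x
  have hkc := hkx.comp (0 : T) hact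
  let N : T → T := fun t => fderiv ℝ (fun t' => G.mul x t t') 0 l'
  have hN : N =ᶠ[nhds 0] fun t => fderiv ℝ (G.H x) (G.K x t) (k (x + G.K x t) l') :=
    (eventually_mem_dom h0).mono fun t ht => fderiv_mul_zero hG ht l'
  have hH' : DifferentiableAt ℝ (fderiv ℝ (G.H x)) (G.K x 0) :=
    ((contDiffAt_H (G.K_mem x 0 h0)).fderiv_right (m := 1) (by norm_cast)).differentiableAt
      (by simp)
  have hNd : DifferentiableAt ℝ N 0 := by
    refine DifferentiableAt.congr_of_eventuallyEq ?_ hN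
    exact (hH'.comp (0 : T) (hasFDerivAt_K h0).differentiableAt).clm_apply
      (hkc.differentiableAt.clm_apply (differentiableAt_const _))
  have hK' : HasFDerivAt (fderiv ℝ (G.K x)) (fderiv ℝ (fderiv ℝ (G.K x)) 0) 0 :=
    (((contDiffAt_K h0).fderiv_right (m := 1) (by norm_cast)).differentiableAt
      (by simp)).hasFDerivAt
  have h1 := hK'.clm_apply hNd.hasFDerivAt
  -- Differentiating `K_x(φ_x(t, t')) = K_x(t) + K_{x'}(t')` at `t' = 0` gives `DK_x(t) N(t) =
  -- k_{f_x(t)} l'`. The derivative at `t = 0`, compared with the product rule in `h1`, is the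
  -- formula.
  have h2 : HasFDerivAt (fun t => fderiv ℝ (G.K x) t (N t))
      (((fderiv ℝ (fun y => (k y : T →L[ℝ] V)) x).comp (k x : T →L[ℝ] V)).flip l') 0 := by
    have h3 := hkc.clm_apply (hasFDerivAt_const l' (0 : T))
    refine (h3.congr_of_eventuallyEq ?_).congr_fderiv (by ext; simp)
    filter_upwards [eventually_mem_dom h0] with t ht
    rw [show N t = _ from fderiv_mul_zero hG ht l', fderiv_K_fderiv_H ht]; rfl
  have h4 := congrArg (fun A : T →L[ℝ] V => A l) (h1.unique h2)
  have hN0 : N 0 = l' := by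
    rw [hN.eq_of_nhds, show (k (x + G.K x 0) : T → V) l' = fderiv ℝ (G.K x) 0 l' by
      rw [hfr, hK0, add_zero]; rfl]
    exact fderiv_H_fderiv_K h0 l'
  have h5 : (k x) (fderiv ℝ N 0 l) + fderiv ℝ (fderiv ℝ (G.K x)) 0 l l'
      = fderiv ℝ (fun y => (k y : T →L[ℝ] V)) x (k x l) l' := by
    simpa [hN0, hfr] using h4
  exact eq_sub_of_add_eq h5

/-- The second derivative of `K_x` at `0` is symmetric and cancels in the antisymmetric part of
`frame_gamma`. -/
theorem gamma_torsion (hG : G.HasFrame k) (hX : IsOpen X)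
    (hk : ContDiffOn ℝ ∞ (fun x => (k x : T →L[ℝ] V)) X) {x : V} (hx : x ∈ X) (l l' : T) :
    G.gamma x l l' - G.gamma x l' l = anholonomity k x l l' := by
  apply (k x).injective
  have hsymm : IsSymmSndFDerivAt ℝ (G.K x) 0 :=
    (contDiffAt_K (G.zero_mem x hx)).isSymmSndFDerivAt
      (by rw [minSmoothness_of_isRCLikeNormedField]; exact ENat.LEInfty.out)
  rw [map_sub, frame_gamma hG hX hk hx, frame_gamma hG hX hk hx, anholonomity,
    ContinuousLinearEquiv.apply_symm_apply, hsymm.eq l l']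
  abel

/-- As an iterated derivative `gamma` is not visibly bilinear; the homogeneity is read off from
`frame_gamma`. -/
theorem gamma_smul_smul (hG : G.HasFrame k) (hX : IsOpen X)
    (hk : ContDiffOn ℝ ∞ (fun x => (k x : T →L[ℝ] V)) X) {x : V} (hx : x ∈ X) (a : ℝ) (l : T) :
    G.gamma x (a • l) (a • l) = (a * a) • G.gamma x l l := by
  apply (k x).injective
  rw [map_smul, frame_gamma hG hX hk hx, frame_gamma hG hX hk hx]
  simp only [map_smul, smul_apply, smul_smul, smul_sub]

namespace IsCanonicalCurve

variable {x : V} {c : ℝ → V} {a b : ℝ}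

theorem base_mem (hc : G.IsCanonicalCurve x c a b) {s : ℝ} (hs : s ∈ Set.Ioo a b) : c s ∈ X := by
  rw [← hc.act_eq s hs]; exact G.target_mem _ _ (hc.mem s hs)

/-- Every condition is open and holds at `s' = 0`. Thus the law on a canonical curve, required only
where the product is defined, is available for small `s'`. -/
theorem eventually_mulDefined (hc : G.IsCanonicalCurve x c a b) {s : ℝ} (hs : s ∈ Set.Ioo a b) :
    ∀ᶠ s' in nhds (0 : ℝ), s + s' ∈ Set.Ioo a b ∧
      (c s, s' • G.velocity c s) ∈ G.dom ∧
      G.MulDefined x (s • G.velocity c 0) (s' • G.velocity c s) := by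
  have hX := hc.base_mem hs
  have hline : ContinuousAt (fun s' : ℝ => s' • G.velocity c s) 0 := by fun_prop
  have h0 : (c s, (0 : ℝ) • G.velocity c s) ∈ G.dom := by rw [zero_smul]; exact G.zero_mem _ hX
  have e1 : ∀ᶠ s' in nhds (0 : ℝ), s + s' ∈ Set.Ioo a b := by
    have : ContinuousAt (fun s' : ℝ => s + s') 0 := by fun_prop
    exact this.preimage_mem_nhds (by rw [add_zero]; exact isOpen_Ioo.mem_nhds hs)
  have e2 : ∀ᶠ s' in nhds (0 : ℝ), (c s, s' • G.velocity c s) ∈ G.dom :=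
    hline.eventually (eventually_mem_dom h0)
  have e3 : ∀ᶠ s' in nhds (0 : ℝ),
      (x, G.K x (s • G.velocity c 0) + G.K (c s) (s' • G.velocity c s)) ∈ G.rng := by
    have hcK : ContinuousAt (G.K (c s)) ((0 : ℝ) • G.velocity c s) :=
      (contDiffAt_K h0).continuousAt
    have : ContinuousAt (fun s' : ℝ => G.K x (s • G.velocity c 0)
        + G.K (c s) (s' • G.velocity c s)) 0 := continuousAt_const.add
      (ContinuousAt.comp (f := fun s' : ℝ => s' • G.velocity c s) hcK hline)
    refine this.eventually (eventually_mem_rng ?_)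
    beta_reduce
    rw [zero_smul, G.K_zero _ hX, add_zero]
    exact G.K_mem _ _ (hc.mem s hs)
  filter_upwards [e1, e2, e3] with s' h1 h2 h3
  refine ⟨h1, h2, hc.mem s hs, ?_, ?_⟩
  · rw [hc.act_eq s hs]; exact h2
  · rw [hc.act_eq s hs]; exact h3

/-- Apply `K_x` to the multiplication law: near each of its points the curve is a ray of the group
at that point. -/
theorem eventually_add (hc : G.IsCanonicalCurve x c a b) {s : ℝ} (hs : s ∈ Set.Ioo a b) :
    ∀ᶠ s' in nhds (0 : ℝ), c (s + s') = c s + G.K (c s) (s' • G.velocity c s) := by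
  filter_upwards [hc.eventually_mulDefined hs] with s' ⟨h1, _, h2⟩
  have h3 := congrArg (G.K x) (hc.mul_eq s s' hs h1 h2)
  rw [mul, G.K_H _ _ h2.2.2, hc.act_eq s hs] at h3
  rw [← hc.act_eq _ h1, act, ← h3, ← add_assoc]
  congr 1
  exact hc.act_eq s hs

theorem contDiffAt (hc : G.IsCanonicalCurve x c a b) {s : ℝ} (hs : s ∈ Set.Ioo a b) :
    ContDiffAt ℝ ∞ c s :=
  hc.smooth.contDiffAt (isOpen_Ioo.mem_nhds hs)

theorem hasDerivAt_base (hc : G.IsCanonicalCurve x c a b) (hG : G.HasFrame k) {s : ℝ}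
    (hs : s ∈ Set.Ioo a b) : HasDerivAt c (k (c s) (G.velocity c s)) s := by
  rw [hG.velocity_eq (hc.base_mem hs), ContinuousLinearEquiv.apply_symm_apply]
  exact ((hc.contDiffAt hs).differentiableAt (by simp)).hasDerivAt

/-- By `eventually_add`, the acceleration at `s` is that of the ray `s' ↦ c(s) + K_{c(s)}(s'w)` at
`s' = 0`, with `w` the frame velocity at `s`. -/
theorem hasDerivAt_deriv (hc : G.IsCanonicalCurve x c a b) {s : ℝ} (hs : s ∈ Set.Ioo a b) :
    HasDerivAt (deriv c) (fderiv ℝ (fderiv ℝ (G.K (c s))) 0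
      (G.velocity c s) (G.velocity c s)) s := by
  have hcX := hc.base_mem hs
  have hadd := hc.eventually_add hs
  have hdef := hc.eventually_mulDefined hs
  generalize G.velocity c s = w at hadd hdef ⊢
  have h0 := G.zero_mem _ hcX
  have hl : ∀ s', HasDerivAt (fun s' : ℝ => s' • w) w s' := fun s' => by
    simpa using (hasDerivAt_id s').smul_const w
  have h1 : ∀ᶠ s' in nhds (0 : ℝ), deriv c (s + s') = fderiv ℝ (G.K (c s)) (s' • w) w := by
    filter_upwards [hadd.eventually_nhds, hdef]
      with s' h2 h3
    have h4 := (hasFDerivAt_K h3.2.1).comp_hasDerivAt s' (hl s')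
    have h5 : HasDerivAt (fun s' => c (s + s')) (fderiv ℝ (G.K (c s)) (s' • w) w) s' :=
      (h4.const_add (c s)).congr_of_eventuallyEq h2
    rw [← h5.deriv]
    exact (deriv_comp_const_add c s s').symm
  have hK' : HasFDerivAt (fderiv ℝ (G.K (c s))) (fderiv ℝ (fderiv ℝ (G.K (c s))) 0)
      ((0 : ℝ) • w) := by
    rw [zero_smul]
    exact (((contDiffAt_K h0).fderiv_right (m := 1) (by norm_cast)).differentiableAt
      (by simp)).hasFDerivAt
  have h6 : HasDerivAt (fun s' : ℝ => fderiv ℝ (G.K (c s)) (s' • w) w)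
      (fderiv ℝ (fderiv ℝ (G.K (c s))) 0 w w) 0 := by
    have h9 : HasDerivAt (fun s' : ℝ => fderiv ℝ (G.K (c s)) (s' • w))
        (fderiv ℝ (fderiv ℝ (G.K (c s))) 0 w) 0 := hK'.comp_hasDerivAt (0 : ℝ) (hl 0)
    simpa using h9.clm_apply (hasDerivAt_const (0 : ℝ) w)
  have h7 : HasDerivAt (fun s' : ℝ => deriv c (s + s'))
      (fderiv ℝ (fderiv ℝ (G.K (c s))) 0 w w) 0 := h6.congr_of_eventuallyEq h1
  rw [← sub_self s] at h7
  have h8 := h7.comp_sub_const s s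
  simpa only [add_sub_cancel] using h8

/-- The acceleration is computed twice, from `ċ = k_c τ` by the product rule and from
`hasDerivAt_deriv`; by `frame_gamma` the difference is `k_c γ(τ, τ)`. -/
theorem hasDerivAt_velocity [FiniteDimensional ℝ V] [FiniteDimensional ℝ T]
    (hc : G.IsCanonicalCurve x c a b) (hG : G.HasFrame k) (hX : IsOpen X)
    (hk : ContDiffOn ℝ ∞ (fun x => (k x : T →L[ℝ] V)) X) {s : ℝ}
    (hs : s ∈ Set.Ioo a b) :
    HasDerivAt (G.velocity c) (-G.gamma (c s) (G.velocity c s) (G.velocity c s)) s := by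
  have hcX := hc.base_mem hs
  have hcd := hc.hasDerivAt_base hG hs
  have hev : ∀ᶠ σ in nhds s, σ ∈ Set.Ioo a b := isOpen_Ioo.mem_nhds hs
  have hdc : DifferentiableAt ℝ (deriv c) s := by
    have h : ContDiffOn ℝ ∞ (deriv c) (Set.Ioo a b) :=
      hc.smooth.deriv_of_isOpen isOpen_Ioo (by simp)
    exact (h.contDiffAt hev).differentiableAt (by simp)
  have hvd : DifferentiableAt ℝ (G.velocity c) s := by
    have h1 : DifferentiableAt ℝ (fun σ => ((k (c σ)).symm : V →L[ℝ] T) (deriv c σ)) s := by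
      have h2 : DifferentiableAt ℝ (fun y => ((k y).symm : V →L[ℝ] T)) (c s) :=
        ((contDiffOn_frame_symm hk).contDiffAt (hX.mem_nhds hcX)).differentiableAt (by simp)
      exact (h2.comp s hcd.differentiableAt).clm_apply hdc
    exact h1.congr_of_eventuallyEq (hev.mono fun σ hσ => hG.velocity_eq (hc.base_mem hσ))
  have hk1 : HasFDerivAt (fun y => (k y : T →L[ℝ] V))
      (fderiv ℝ (fun y => (k y : T →L[ℝ] V)) (c s)) (c s) :=
    ((hk.contDiffAt (hX.mem_nhds hcX)).differentiableAt (by simp)).hasFDerivAt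
  have hA : HasDerivAt (deriv c) (fderiv ℝ (fun y => (k y : T →L[ℝ] V)) (c s)
      (k (c s) (G.velocity c s)) (G.velocity c s) + k (c s) (deriv (G.velocity c) s)) s := by
    have h1 := (hk1.comp_hasDerivAt s hcd).clm_apply hvd.hasDerivAt
    exact h1.congr_of_eventuallyEq (hev.mono fun σ hσ => (hc.hasDerivAt_base hG hσ).deriv)
  have hB := hc.hasDerivAt_deriv hs
  have hfin : deriv (G.velocity c) s = -G.gamma (c s) (G.velocity c s) (G.velocity c s) := by
    apply (k (c s)).injective
    rw [map_neg, frame_gamma hG hX hk hcX, neg_sub, ← hA.unique hB, add_sub_cancel_left]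
  rw [← hfin]
  exact hvd.hasDerivAt

end IsCanonicalCurve

end TranslationGroup

end GroupCalculus

/-! ### Geodesics and parallel transport: invariance and uniqueness -/

section Geodesics

variable {V : Type*} [NormedAddCommGroup V] [NormedSpace ℝ V]
variable {T : Type*} [NormedAddCommGroup T] [InnerProductSpace ℝ T] [FiniteDimensional ℝ T]
variable {X : Set V} {k : V → T ≃L[ℝ] V}

/-- `c` is on `S` a geodesic of the metric for which the frame `k` is orthonormal, with velocity `v`
in this frame. -/
def IsGeodesicOn (X : Set V) (k : V → T ≃L[ℝ] V) (c : ℝ → V) (v : ℝ → T) (S : Set ℝ) : Prop :=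
  ∀ s ∈ S, c s ∈ X ∧ HasDerivAt c (k (c s) (v s)) s ∧
    HasDerivAt v (-(leviCivita k (c s) (v s) (v s))) s

/-- `B` is on `S` a family of parallel transports along the curve `c` with velocity `v`. -/
def IsTransportOn (k : V → T ≃L[ℝ] V) (c : ℝ → V) (v : ℝ → T) (B : ℝ → T →L[ℝ] T) (S : Set ℝ) :
    Prop :=
  ∀ s ∈ S, HasDerivAt B (-((leviCivita k (c s) (v s)).comp (B s))) s

theorem leviCivita_skew (k : V → T ≃L[ℝ] V) (x : V) (t θ : T) :
    inner ℝ θ (leviCivita k x t θ) = 0 := by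
  have h := (isLeviCivita_leviCivita Set.univ k).skew (Set.mem_univ x) t θ θ
  linarith

theorem norm_eq_of_parallel {c : ℝ → V} {v u : ℝ → T} {b : ℝ}
    (hu : ∀ s ∈ Set.Icc 0 b, HasDerivWithinAt u (-(leviCivita k (c s) (v s) (u s)))
      (Set.Icc 0 b) s) {s : ℝ} (hs : s ∈ Set.Icc 0 b) : ‖u s‖ = ‖u 0‖ := by
  have hd : ∀ s ∈ Set.Icc 0 b, HasDerivWithinAt (fun s => inner ℝ (u s) (u s)) 0 (Set.Icc 0 b) s := by
    intro s hs
    have h := (hu s hs).inner ℝ (hu s hs)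
    simpa [inner_neg_left, inner_neg_right, leviCivita_skew,
      real_inner_comm (u s) (leviCivita k (c s) (v s) (u s))] using h
  have h2 := constant_of_derivWithin_zero (fun s hs => (hd s hs).differentiableWithinAt)
    (fun s hs => (hd s (Set.Ico_subset_Icc_self hs)).derivWithin
      (uniqueDiffOn_Icc (hs.1.trans_lt hs.2) s (Set.Ico_subset_Icc_self hs))) s hs
  simp only [real_inner_self_eq_norm_sq] at h2
  exact (sq_eq_sq₀ (norm_nonneg _) (norm_nonneg _)).1 h2

/-- The difference is parallel, hence of constant norm, and starts at zero. Skewness replaces a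
Lipschitz bound, so no regularity of `c` or `v` is needed. -/
theorem eqOn_of_parallel {c : ℝ → V} {v u w : ℝ → T} {b : ℝ}
    (hu : ∀ s ∈ Set.Icc 0 b, HasDerivWithinAt u (-(leviCivita k (c s) (v s) (u s)))
      (Set.Icc 0 b) s)
    (hw : ∀ s ∈ Set.Icc 0 b, HasDerivWithinAt w (-(leviCivita k (c s) (v s) (w s)))
      (Set.Icc 0 b) s) (h0 : u 0 = w 0) {s : ℝ} (hs : s ∈ Set.Icc 0 b) : u s = w s := by
  have h := norm_eq_of_parallel (k := k) (c := c) (v := v) (u := fun s => u s - w s)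
    (fun s hs => ((hu s hs).sub (hw s hs)).congr_deriv (by simp only [map_sub]; abel)) hs
  rw [h0, sub_self, norm_zero, norm_eq_zero] at h
  exact sub_eq_zero.1 h

theorem IsTransportOn.hasDerivAt_apply {c : ℝ → V} {v : ℝ → T} {B : ℝ → T →L[ℝ] T} {S : Set ℝ}
    (hB : IsTransportOn k c v B S) {s : ℝ} (hs : s ∈ S) (θ : T) :
    HasDerivAt (fun s => B s θ) (-(leviCivita k (c s) (v s) (B s θ))) s := by
  simpa using (hB s hs).clm_apply (hasDerivAt_const s θ)

theorem IsTransportOn.norm_apply {c : ℝ → V} {v : ℝ → T} {B : ℝ → T →L[ℝ] T} {b : ℝ}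
    (hB : IsTransportOn k c v B (Set.Icc 0 b)) {s : ℝ} (hs : s ∈ Set.Icc 0 b) (θ : T) :
    ‖B s θ‖ = ‖B 0 θ‖ :=
  norm_eq_of_parallel (k := k) (c := c) (v := v) (u := fun s => B s θ)
    (fun _ hs => (hB.hasDerivAt_apply hs θ).hasDerivWithinAt) hs

theorem IsTransportOn.eqOn {c c' : ℝ → V} {v v' : ℝ → T} {B B' : ℝ → T →L[ℝ] T} {b : ℝ}
    (hB : IsTransportOn k c v B (Set.Icc 0 b)) (hB' : IsTransportOn k c' v' B' (Set.Icc 0 b))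
    (hc : Set.EqOn c c' (Set.Icc 0 b)) (hv : Set.EqOn v v' (Set.Icc 0 b)) (h0 : B 0 = B' 0) :
    Set.EqOn B B' (Set.Icc 0 b) := by
  intro s hs
  ext θ
  refine eqOn_of_parallel (k := k) (c := c) (v := v) (u := fun s => B s θ) (w := fun s => B' s θ)
    (fun _ hs => (hB.hasDerivAt_apply hs θ).hasDerivWithinAt)
    (fun s hs => ?_) (by simp only [h0]) hs
  rw [hc hs, hv hs]
  exact (hB'.hasDerivAt_apply hs θ).hasDerivWithinAt

/-- The geodesic equation is autonomous and quadratic in the velocity, so shifts and rescalings of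
time preserve it. -/
theorem IsGeodesicOn.comp_affine {c : ℝ → V} {v : ℝ → T} {S S' : Set ℝ}
    (h : IsGeodesicOn X k c v S) (p a : ℝ) (hS : ∀ s ∈ S', p + a * s ∈ S) :
    IsGeodesicOn X k (fun s => c (p + a * s)) (fun s => a • v (p + a * s)) S' := by
  intro s hs
  obtain ⟨h1, h2, h3⟩ := h _ (hS s hs)
  have hl : HasDerivAt (fun s => p + a * s) a s := by
    simpa using ((hasDerivAt_id s).const_mul a).const_add p
  refine ⟨h1, ?_, ?_⟩
  · have h4 := h2.scomp s hl
    rw [← map_smul] at h4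
    exact h4
  · have h4 : HasDerivAt (fun s => a • v (p + a * s)) _ s := (h3.scomp s hl).const_smul a
    refine h4.congr_deriv ?_
    simp only [map_smul, smul_apply, smul_neg]

/-- The constant right factor `A` serves to restart the transport with value `1` at another time. -/
theorem IsTransportOn.comp_affine {c : ℝ → V} {v : ℝ → T} {B : ℝ → T →L[ℝ] T} {S S' : Set ℝ}
    (h : IsTransportOn k c v B S) (p a : ℝ) (A : T →L[ℝ] T) (hS : ∀ s ∈ S', p + a * s ∈ S) :
    IsTransportOn k (fun s => c (p + a * s)) (fun s => a • v (p + a * s))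
      (fun s => (B (p + a * s)).comp A) S' := by
  intro s hs
  have hl : HasDerivAt (fun s => p + a * s) a s := by
    simpa using ((hasDerivAt_id s).const_mul a).const_add p
  have h1 : HasDerivAt (fun s => B (p + a * s)) _ s := (h _ (hS s hs)).scomp s hl
  refine (h1.clm_comp (hasDerivAt_const s A)).congr_deriv ?_
  ext θ
  simp

variable [FiniteDimensional ℝ V]

theorem IsGeodesicOn.eqOn (hX : IsOpen X)
    (hk : ContDiffOn ℝ ∞ (fun x => (k x : T →L[ℝ] V)) X) {c c' : ℝ → V} {v v' : ℝ → T} {b : ℝ}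
    (h : IsGeodesicOn X k c v (Set.Icc 0 b)) (h' : IsGeodesicOn X k c' v' (Set.Icc 0 b))
    (hc : c 0 = c' 0) (hv : v 0 = v' 0) :
    Set.EqOn c c' (Set.Icc 0 b) ∧ Set.EqOn v v' (Set.Icc 0 b) := by
  let f : V × T → V × T := fun p => (k p.1 p.2, -(leviCivita k p.1 p.2 p.2))
  have hfst : ContDiffOn ℝ ∞ (fun p : V × T => p.1) (X ×ˢ (Set.univ : Set T)) := contDiffOn_fst
  have hsnd : ContDiffOn ℝ ∞ (fun p : V × T => p.2) (X ×ˢ (Set.univ : Set T)) := contDiffOn_snd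
  have hf : ContDiffOn ℝ 1 f (X ×ˢ (Set.univ : Set T)) := by
    refine ContDiffOn.of_le (n := ∞) (ContDiffOn.prodMk ?_ (ContDiffOn.neg ?_)) (by simp)
    · exact (hk.comp hfst fun p hp => hp.1).clm_apply hsnd
    · exact (((contDiffOn_leviCivita hX hk).comp hfst fun p hp => hp.1).clm_apply hsnd).clm_apply
        hsnd
  have key := eqOn_Icc_of_integralCurves (hX.prod isOpen_univ) hf
    (y₁ := fun s => (c s, v s)) (y₂ := fun s => (c' s, v' s)) (a := 0) (b := b)
    (fun s hs => ⟨⟨(h s hs).1, Set.mem_univ _⟩, (h s hs).2.1.prodMk (h s hs).2.2⟩)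
    (fun s hs => ⟨⟨(h' s hs).1, Set.mem_univ _⟩, (h' s hs).2.1.prodMk (h' s hs).2.2⟩)
    (Prod.ext hc hv)
  exact ⟨fun s hs => congrArg Prod.fst (key hs), fun s hs => congrArg Prod.snd (key hs)⟩

end Geodesics

theorem HasDerivAt.of_mul_eq_one {R : Type*} [NormedRing R] [NormedAlgebra ℝ R] [CompleteSpace R]
    {A B : ℝ → R} {A' : R} {s : ℝ} (hAB : ∀ s, A s * B s = 1) (hBA : ∀ s, B s * A s = 1)
    (hA : HasDerivAt A A' s) : HasDerivAt B (-(B s * A' * B s)) s := by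
  let u : ℝ → Rˣ := fun s => ⟨A s, B s, hAB s, hBA s⟩
  have h1 := (hasFDerivAt_ringInverse (𝕜 := ℝ) (u s)).comp_hasDerivAt s
    (show HasDerivAt (fun s => (u s : R)) A' s from hA)
  have h2 : (fun s => Ring.inverse (u s : R)) = B := by
    funext s
    rw [Ring.inverse_unit]; rfl
  have h3 : HasDerivAt (fun s => Ring.inverse (u s : R)) _ s := h1
  rw [h2] at h3
  exact h3.congr_deriv (by simp [u])

/-! ### Rays of canonical groups are geodesics; rotations as inverse transports -/

section Canonical

variable {V : Type*} [NormedAddCommGroup V] [NormedSpace ℝ V] [FiniteDimensional ℝ V]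
variable {T : Type*} [NormedAddCommGroup T] [InnerProductSpace ℝ T] [FiniteDimensional ℝ T]
variable {X : Set V} {k : V → T ≃L[ℝ] V}

namespace TranslationGroup

variable {G : TranslationGroup X T}

/-- `H_x` inverts `K_x` and `φ_x` is built from both, so the rest of the structure follows from `K`
on the common domain. -/
theorem Coincide.of_K_eq {G G' : TranslationGroup X T}
    (h : ∀ x t, (x, t) ∈ G.dom → (x, t) ∈ G'.dom → G.K x t = G'.K x t) : G.Coincide G' := by
  have hH : ∀ x u, (x, u) ∈ G.rng → (x, G.H x u) ∈ G'.dom →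
      (x, u) ∈ G'.rng ∧ G.H x u = G'.H x u := by
    intro x u hu hd
    have h1 := h x _ (G.H_mem x u hu) hd
    rw [G.K_H x u hu] at h1
    have h2 := G'.K_mem x _ hd
    have h3 := G'.H_K x _ hd
    rw [← h1] at h2 h3
    exact ⟨h2, h3.symm⟩
  refine ⟨h, hH, fun x t t' hm hd hd' hd'' => ?_⟩
  have e1 := h x t hm.1 hd
  have e2 : G.act x t = G'.act x t := by rw [act, act, e1]
  have e3 := h _ t' hm.2.1 hd'
  obtain ⟨h1, h2⟩ := hH x _ hm.2.2 hd''
  rw [e3, e2, e1] at h1 h2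
  exact ⟨⟨hd, by rw [← e2]; exact hd', h1⟩, by rw [mul, mul, ← h2, e3, e1, e2]⟩

namespace IsCanonicalCurve

variable {x : V} {c : ℝ → V} {a b : ℝ}

theorem isGeodesicOn (hc : G.IsCanonicalCurve x c a b) (hG : G.HasFrame k) (hX : IsOpen X)
    (hk : ContDiffOn ℝ ∞ (fun x => (k x : T →L[ℝ] V)) X)
    (hγ : ∀ x ∈ X, ∀ l l' : T, G.gamma x l l' = leviCivita k x l l') :
    IsGeodesicOn X k c (G.velocity c) (Set.Ioo a b) := by
  intro s hs
  refine ⟨hc.base_mem hs, hc.hasDerivAt_base hG hs, ?_⟩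
  rw [← hγ _ (hc.base_mem hs)]
  exact hc.hasDerivAt_velocity hG hX hk hs

end IsCanonicalCurve

/-- By injectivity of `K_x`, the curve that canonicity supplies through `f_x(t)` is the ray of `t`,
up to the time scale `S`. -/
theorem smul_velocity_eq_of_canonicalCurve {x : V} {t : T} {c : ℝ → V} {a b S : ℝ}
    (hc : G.IsCanonicalCurve x c a b) (hS : S ∈ Set.Ioo a b)
    (ht : (x, t) ∈ G.dom) (hcS : c S = G.act x t) : S • G.velocity c 0 = t := by
  have h1 := hc.act_eq S hS
  rw [hcS, act, act, add_left_cancel_iff] at h1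
  rw [← G.H_K x t ht, ← h1, G.H_K _ _ (hc.mem S hS)]

/-- `S` may be zero or negative; it is enough that the interval is star-shaped about `0`. -/
theorem IsCanonicalCurve.mul_mem {x : V} {c : ℝ → V} {a b S s : ℝ}
    (hc : G.IsCanonicalCurve x c a b) (hS : S ∈ Set.Ioo a b) (hs : s ∈ Set.Icc (0 : ℝ) 1) :
    S * s ∈ Set.Ioo a b := by
  have h : StarConvex ℝ (0 : ℝ) (Set.Ioo a b) := (convex_Ioo a b).starConvex ⟨hc.neg, hc.pos⟩
  have := h.smul_mem (x := S) (by simpa using hS) hs.1 hs.2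
  simpa [mul_comm] using this

theorem IsCanonicalCurve.eventually_mul_mem {x : V} {c : ℝ → V} {a b S s : ℝ}
    (hc : G.IsCanonicalCurve x c a b) (hS : S ∈ Set.Ioo a b) (hs : s ∈ Set.Icc (0 : ℝ) 1) :
    ∀ᶠ σ in nhds s, S * σ ∈ Set.Ioo a b :=
  (continuous_const_mul S).continuousAt.preimage_mem_nhds
    (isOpen_Ioo.mem_nhds (hc.mul_mem hS hs))

theorem IsCanonicalCurve.act_smul {x : V} {t : T} {c : ℝ → V} {a b S s : ℝ}
    (hc : G.IsCanonicalCurve x c a b) (hS : S • G.velocity c 0 = t)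
    (hs : S * s ∈ Set.Ioo a b) : G.act x (s • t) = c (S * s) := by
  rw [← hc.act_eq _ hs, ← hS, smul_smul, mul_comm]

theorem IsCanonicalCurve.smul_mem {x : V} {t : T} {c : ℝ → V} {a b S s : ℝ}
    (hc : G.IsCanonicalCurve x c a b) (hS : S • G.velocity c 0 = t)
    (hs : S * s ∈ Set.Ioo a b) : (x, s • t) ∈ G.dom := by
  rw [← hS, smul_smul, mul_comm]; exact hc.mem _ hs

theorem IsCanonicalCurve.isGeodesicOn_act {x : V} {t : T} {c : ℝ → V} {a b S : ℝ}
    (hc : G.IsCanonicalCurve x c a b) (hSm : S ∈ Set.Ioo a b) (hS : S • G.velocity c 0 = t)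
    (hG : G.HasFrame k) (hX : IsOpen X) (hk : ContDiffOn ℝ ∞ (fun x => (k x : T →L[ℝ] V)) X)
    (hγ : ∀ x ∈ X, ∀ l l' : T, G.gamma x l l' = leviCivita k x l l') :
    IsGeodesicOn X k (fun s => G.act x (s • t)) (fun s => S • G.velocity c (S * s))
      (Set.Icc 0 1) := by
  have h := (hc.isGeodesicOn hG hX hk hγ).comp_affine (S' := Set.Icc 0 1) 0 S
    (fun s hs => by rw [zero_add]; exact hc.mul_mem hSm hs)
  simp only [zero_add] at h
  intro s hs
  -- Two-sided derivatives at `0` and `1` need a neighbourhood, which the open interval of the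
  -- canonical curve provides.
  have h1 : (fun s => G.act x (s • t)) =ᶠ[nhds s] fun s => c (S * s) :=
    (hc.eventually_mul_mem hSm hs).mono fun σ hσ => hc.act_smul hS hσ
  obtain ⟨g1, g2, g3⟩ := h s hs
  have h2 : c (S * s) = G.act x (s • t) := h1.eq_of_nhds.symm
  beta_reduce at g1 g2 g3
  rw [h2] at g1 g2 g3
  exact ⟨g1, g2.congr_of_eventuallyEq h1, g3⟩

/-- In a canonical group with the Levi-Civita connection, the rays are geodesics. -/
theorem IsCanonical.isGeodesicOn (hcan : G.IsCanonical) (hG : G.HasFrame k) (hX : IsOpen X)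
    (hk : ContDiffOn ℝ ∞ (fun x => (k x : T →L[ℝ] V)) X)
    (hγ : ∀ x ∈ X, ∀ l l' : T, G.gamma x l l' = leviCivita k x l l') {x : V} {t : T}
    (ht : (x, t) ∈ G.dom) :
    ∃ v : ℝ → T, v 0 = t ∧ IsGeodesicOn X k (fun s => G.act x (s • t)) v (Set.Icc 0 1) := by
  obtain ⟨c, a, b, S, hc, hSm, hcS⟩ := hcan x (G.act x t)
    (by rw [act, add_sub_cancel_left]; exact G.K_mem x t ht)
  have hS := smul_velocity_eq_of_canonicalCurve hc hSm ht hcS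
  exact ⟨_, by simpa using hS, hc.isGeodesicOn_act hSm hS hG hX hk hγ⟩

/-- The two rays of `t` are geodesics with the same initial data, so they agree at time `1`. -/
theorem IsCanonical.coincide {G' : TranslationGroup X T} (hcan : G.IsCanonical)
    (hcan' : G'.IsCanonical) (hG : G.HasFrame k) (hG' : G'.HasFrame k) (hX : IsOpen X)
    (hk : ContDiffOn ℝ ∞ (fun x => (k x : T →L[ℝ] V)) X)
    (hγ : ∀ x ∈ X, ∀ l l' : T, G.gamma x l l' = leviCivita k x l l')
    (hγ' : ∀ x ∈ X, ∀ l l' : T, G'.gamma x l l' = leviCivita k x l l') : G.Coincide G' := by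
  refine Coincide.of_K_eq fun x t ht ht' => ?_
  have hx := G.base_mem x t ht
  obtain ⟨v, hv, hg⟩ := hcan.isGeodesicOn hG hX hk hγ ht
  obtain ⟨v', hv', hg'⟩ := hcan'.isGeodesicOn hG' hX hk hγ' ht'
  have h := (hg.eqOn hX hk hg' (by simp [act, G.K_zero x hx, G'.K_zero x hx])
    (hv.trans hv'.symm)).1 (Set.right_mem_Icc.2 zero_le_one)
  simpa [act] using h

end TranslationGroup

namespace MotionGroup

variable {R : TranslationGroup X T} {P : MotionGroup X T}

theorem IsCanonicalCurve.toTranslationGroup {x : V} {c : ℝ → V} {a b : ℝ}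
    (hc : P.IsCanonicalCurve x c a b) : P.toTranslationGroup.IsCanonicalCurve x c a b :=
  ⟨hc.neg, hc.pos, hc.smooth, hc.start, hc.mem, hc.act_eq,
    fun s s' hs hs' hd => congrArg Prod.fst (hc.mul_eq s s' hs hs' hd)⟩

theorem IsParallelTransport.isCanonical (hP : IsParallelTransport R P) :
    P.toTranslationGroup.IsCanonical := fun x x' h => by
  obtain ⟨c, a, b, S, hc, hS⟩ := hP.canonical x x' h
  exact ⟨c, a, b, S, hc.toTranslationGroup, hS⟩

theorem IsTangentMotion.hasFrame (hP : IsTangentMotion R P) (hR : R.HasFrame k) :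
    P.toTranslationGroup.HasFrame k := fun x hx => (hP.frame x hx).trans (hR x hx)

theorem differentiableAt_rotL {x : V} {t : T} (h : (x, t) ∈ P.dom) :
    DifferentiableAt ℝ (P.rotL x) t :=
  (ContDiffAt.comp (g := fun p : V × T => P.rotL p.1 p.2) (f := fun t => (x, t)) t
    (P.smooth_rot.contDiffAt (P.isOpen_dom.mem_nhds h))
    (contDiffAt_const.prodMk contDiffAt_id)).differentiableAt (n := ∞) (by simp)

theorem rotL_zero {x : V} (hx : x ∈ X) : P.rotL x 0 = 1 := by
  ext θ
  simp [rotL, P.rot_zero x hx]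

theorem inner_rotL (x : V) (t θ θ' : T) :
    inner ℝ (P.rotL x t θ) (P.rotL x t θ') = inner ℝ θ θ' :=
  (P.rot x t).inner_map_map θ θ'

/-- Differentiating `⟨π τ, π τ'⟩ = ⟨τ, τ'⟩` at `0` shows that `γ = ∂π(0)` is skew, and
`gamma_torsion` gives its torsion. -/
theorem IsTangentMotion.isLeviCivita (hP : IsTangentMotion R P) (hR : R.HasFrame k)
    (hX : IsOpen X) (hk : ContDiffOn ℝ ∞ (fun x => (k x : T →L[ℝ] V)) X) :
    IsLeviCivita X k R.gamma := by
  refine isLeviCivita_of_skew_of_torsion (fun x hx t τ τ' => ?_)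
    (fun x hx l l' => TranslationGroup.gamma_torsion hR hX hk hx l l')
  rw [← hP.connection x hx, ← hP.connection x hx]
  have hd := (differentiableAt_rotL (P.zero_mem x hx)).hasFDerivAt
  have h1 := hd.clm_apply (hasFDerivAt_const τ (0 : T))
  have h2 := hd.clm_apply (hasFDerivAt_const τ' (0 : T))
  have h3 := h1.inner ℝ h2
  simp only [inner_rotL] at h3
  have h4 := congrArg (fun A : T →L[ℝ] ℝ => A t) (h3.unique (hasFDerivAt_const _ _))
  simp [rotL_zero hx] at h4
  rw [real_inner_comm (fderiv ℝ (P.rotL x) 0 t τ) τ']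
  linarith

theorem IsTangentMotion.gamma_eq (hP : IsTangentMotion R P) (hR : R.HasFrame k)
    (hX : IsOpen X) (hk : ContDiffOn ℝ ∞ (fun x => (k x : T →L[ℝ] V)) X) :
    ∀ x ∈ X, ∀ l l' : T, R.gamma x l l' = leviCivita k x l l' := fun _ hx l l' =>
  (hP.isLeviCivita hR hX hk).unique (isLeviCivita_leviCivita X k) hx l l'

theorem IsParallelTransport.gamma_eq (hP : IsParallelTransport R P) (hR : R.HasFrame k)
    (hX : IsOpen X) (hk : ContDiffOn ℝ ∞ (fun x => (k x : T →L[ℝ] V)) X) :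
    ∀ x ∈ X, ∀ l l' : T, P.gamma x l l' = leviCivita k x l l' := fun x hx l l' =>
  (hP.base_connection x hx l l').trans (hP.motion.gamma_eq hR hX hk x hx l l')

theorem IsTangentMotion.fderiv_rotL (hP : IsTangentMotion R P) (hR : R.HasFrame k)
    (hX : IsOpen X) (hk : ContDiffOn ℝ ∞ (fun x => (k x : T →L[ℝ] V)) X) {x : V} (hx : x ∈ X)
    (l : T) : fderiv ℝ (P.rotL x) 0 l = leviCivita k x l := by
  ext θ
  rw [hP.connection x hx, hP.gamma_eq hR hX hk x hx]

/-- The rotation component of the extended law is `π_x((s + s')τ_x) = π_x(sτ_x)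
π_{c(s)}(s'τ_{c(s)})`; differentiate at `s' = 0`, where `∂π(0)` is the connection. -/
theorem IsCanonicalCurve.hasDerivAt_rotL {x : V} {c : ℝ → V} {a b : ℝ}
    (hc : P.IsCanonicalCurve x c a b) (hP : IsTangentMotion R P) (hR : R.HasFrame k)
    (hX : IsOpen X) (hk : ContDiffOn ℝ ∞ (fun x => (k x : T →L[ℝ] V)) X) {s : ℝ}
    (hs : s ∈ Set.Ioo a b) :
    HasDerivAt (fun s => P.rotL x (s • P.velocity c 0))
      ((P.rotL x (s • P.velocity c 0)).comp (leviCivita k (c s) (P.velocity c s))) s := by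
  have hcX := hc.toTranslationGroup.base_mem hs
  have hev : ∀ᶠ s' in nhds (0 : ℝ), P.rotL x ((s + s') • P.velocity c 0)
      = (P.rotL x (s • P.velocity c 0)).comp (P.rotL (c s) (s' • P.velocity c s)) := by
    filter_upwards [hc.toTranslationGroup.eventually_mulDefined hs] with s' ⟨h1, _, h3⟩
    have h4 := hc.mul_eq s s' hs h1 h3
    have h5 := congrArg Prod.fst h4
    have h6 := congrArg Prod.snd h4
    simp only [motionMul] at h5 h6
    rw [h5, hc.act_eq s hs, one_mul, mul_one, mul_inv_eq_one] at h6
    ext θ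
    exact (congrArg (fun r : T ≃ₗᵢ[ℝ] T => r θ) h6).symm
  have hl : HasDerivAt (fun s' : ℝ => s' • P.velocity c s) (P.velocity c s) 0 := by
    simpa using (hasDerivAt_id (0 : ℝ)).smul_const (P.velocity c s)
  have hr : HasFDerivAt (P.rotL (c s)) (fderiv ℝ (P.rotL (c s)) 0)
      ((0 : ℝ) • P.velocity c s) := by
    rw [zero_smul]; exact (differentiableAt_rotL (P.zero_mem _ hcX)).hasFDerivAt
  have h1 : HasDerivAt (fun s' : ℝ => P.rotL (c s) (s' • P.velocity c s))
      (leviCivita k (c s) (P.velocity c s)) 0 := by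
    rw [← hP.fderiv_rotL hR hX hk hcX]; exact hr.comp_hasDerivAt (0 : ℝ) hl
  have h2 : HasDerivAt (fun s' : ℝ => P.rotL x ((s + s') • P.velocity c 0))
      ((P.rotL x (s • P.velocity c 0)).comp (leviCivita k (c s) (P.velocity c s))) 0 :=
    (((hasDerivAt_const (0 : ℝ) (P.rotL x (s • P.velocity c 0))).clm_comp h1).congr_deriv
      (by ext; simp)).congr_of_eventuallyEq hev
  have h3 := (show HasDerivAt (fun s' : ℝ => P.rotL x ((s + s') • P.velocity c 0))
      ((P.rotL x (s • P.velocity c 0)).comp (leviCivita k (c s) (P.velocity c s))) (s - s) by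
    rw [sub_self]; exact h2).comp_sub_const s s
  simpa only [add_sub_cancel] using h3

/-- The inverse of the rotation, as a linear map. -/
noncomputable def rotInv (P : MotionGroup X T) (x : V) (t : T) : T →L[ℝ] T :=
  ((P.rot x t)⁻¹.toContinuousLinearEquiv : T →L[ℝ] T)

theorem rotL_mul_rotInv (P : MotionGroup X T) (x : V) (t : T) :
    P.rotL x t * P.rotInv x t = 1 := by
  ext θ
  exact congrArg (fun r : T ≃ₗᵢ[ℝ] T => r θ) (mul_inv_cancel (P.rot x t))

theorem rotInv_mul_rotL (P : MotionGroup X T) (x : V) (t : T) :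
    P.rotInv x t * P.rotL x t = 1 := by
  ext θ
  exact congrArg (fun r : T ≃ₗᵢ[ℝ] T => r θ) (inv_mul_cancel (P.rot x t))

/-- Along the rays of a group of parallel transports, which are geodesics, the rotations are the
inverse parallel transports. -/
theorem IsParallelTransport.exists_geodesic (hP : IsParallelTransport R P) (hR : R.HasFrame k)
    (hX : IsOpen X) (hk : ContDiffOn ℝ ∞ (fun x => (k x : T →L[ℝ] V)) X) {x : V} {t : T}
    (ht : (x, t) ∈ P.dom) :
    ∃ v : ℝ → T, v 0 = t ∧ (∀ s ∈ Set.Icc (0 : ℝ) 1, (x, s • t) ∈ P.dom) ∧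
      IsGeodesicOn X k (fun s => P.act x (s • t)) v (Set.Icc 0 1) ∧
      (∀ s ∈ Set.Icc (0 : ℝ) 1, HasDerivAt (fun s => P.rotL x (s • t))
        ((P.rotL x (s • t)).comp (leviCivita k (P.act x (s • t)) (v s))) s) ∧
      IsTransportOn k (fun s => P.act x (s • t)) v (fun s => P.rotInv x (s • t))
        (Set.Icc 0 1) := by
  obtain ⟨c, a, b, S, hc, hSm, hcS⟩ := hP.canonical x (P.act x t)
    (by rw [TranslationGroup.act, add_sub_cancel_left]; exact P.K_mem x t ht)
  have hc' := hc.toTranslationGroup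
  have hS := TranslationGroup.smul_velocity_eq_of_canonicalCurve hc' hSm ht hcS
  have hrot : ∀ s ∈ Set.Icc (0 : ℝ) 1, HasDerivAt (fun s => P.rotL x (s • t))
        ((P.rotL x (s • t)).comp
          (leviCivita k (P.act x (s • t)) (S • P.velocity c (S * s)))) s := by
    intro s hs
    have h1 := hc.hasDerivAt_rotL hP.motion hR hX hk (hc'.mul_mem hSm hs)
    have hl : HasDerivAt (fun s => S * s) S s := by simpa using (hasDerivAt_id s).const_mul S
    have h2 := h1.scomp s hl
    have h3 : (fun s => P.rotL x (s • t)) =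
        ((fun s => P.rotL x (s • P.velocity c 0)) ∘ fun s => S * s) := by
      funext s
      simp only [Function.comp, ← hS, smul_smul, mul_comm]
    rw [h3]
    refine h2.congr_deriv ?_
    rw [hc'.act_smul hS (hc'.mul_mem hSm hs), ← hS, smul_smul, mul_comm s S]
    ext θ
    simp
  refine ⟨fun s => S • P.velocity c (S * s), by simpa using hS,
    fun s hs => hc'.smul_mem hS (hc'.mul_mem hSm hs),
    hc'.isGeodesicOn_act hSm hS (hP.motion.hasFrame hR) hX hk (hP.gamma_eq hR hX hk), hrot,
    fun s hs => ?_⟩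
  -- From `π' = πγ`, the inverse `B = π⁻¹` satisfies `B' = -Bπ'B = -γB`.
  refine (HasDerivAt.of_mul_eq_one (fun s => P.rotL_mul_rotInv x (s • t))
    (fun s => P.rotInv_mul_rotL x (s • t)) (hrot s hs)).congr_deriv ?_
  have h := P.rotInv_mul_rotL x (s • t)
  change -(P.rotInv x (s • t) * (P.rotL x (s • t) * _) * _) = -(_ * _)
  rw [← mul_assoc (P.rotInv x (s • t)), h, one_mul]

end MotionGroup

end Canonical

/-! ### Uniqueness of the group and the two descriptions of its rotations -/

section ParallelTransport

variable {V : Type*} [NormedAddCommGroup V] [NormedSpace ℝ V] [FiniteDimensional ℝ V]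
variable {T : Type*} [NormedAddCommGroup T] [InnerProductSpace ℝ T] [FiniteDimensional ℝ T]
variable {X : Set V} {k : V → T ≃L[ℝ] V}

namespace MotionGroup

variable {R R' : TranslationGroup X T} {P P' : MotionGroup X T}

/-- The group of parallel transports is determined by the frame field. -/
theorem IsParallelTransport.coincide (hP : IsParallelTransport R P) (hR : R.HasFrame k)
    (hP' : IsParallelTransport R' P') (hR' : R'.HasFrame k)
    (hX : IsOpen X) (hk : ContDiffOn ℝ ∞ (fun x => (k x : T →L[ℝ] V)) X) : P.Coincide P' := by
  have htr := hP.isCanonical.coincide hP'.isCanonical (hP.motion.hasFrame hR)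
    (hP'.motion.hasFrame hR') hX hk (hP.gamma_eq hR hX hk) (hP'.gamma_eq hR' hX hk)
  have hrot : ∀ x t, (x, t) ∈ P.dom → (x, t) ∈ P'.dom → P.rot x t = P'.rot x t := by
    intro x t ht ht'
    have hx := P.base_mem x t ht
    obtain ⟨v, hv, -, hg, -, hB⟩ := hP.exists_geodesic hR hX hk ht
    obtain ⟨v', hv', -, hg', -, hB'⟩ := hP'.exists_geodesic hR' hX hk ht'
    have h := hg.eqOn hX hk hg' (by simp [TranslationGroup.act, P.K_zero x hx, P'.K_zero x hx])
      (hv.trans hv'.symm)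
    have h1 := hB.eqOn hB' h.1 h.2 (by
      ext θ
      simp [rotInv, P.rot_zero x hx, P'.rot_zero x hx]) (Set.right_mem_Icc.2 zero_le_one)
    simp only [one_smul] at h1
    rw [← inv_inj]
    ext θ
    exact congrArg (fun A : T →L[ℝ] T => A θ) h1
  refine ⟨htr, hrot, fun x ϑ ϑ' hm h1 h2 h3 => ?_⟩
  obtain ⟨h4, h5⟩ := htr.mul_eq x _ _ hm h1 h2 h3
  refine ⟨h4, ?_⟩
  have hact : P.act x ϑ.1 = P'.act x ϑ.1 := by
    rw [TranslationGroup.act, TranslationGroup.act, htr.K_eq x _ hm.1 h1]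
  have h6 : P.rot x (P.mul x ϑ.1 ϑ'.1) = P'.rot x (P.mul x ϑ.1 ϑ'.1) :=
    hrot x _ (P.H_mem _ _ hm.2.2) h3
  rw [motionMul, motionMul, h6, hrot x _ hm.1 h1, hrot _ _ hm.2.1 h2, h5, hact]

theorem IsParallelTransport.coincide_base (hP : IsParallelTransport R P) (hR : R.HasFrame k)
    (hcan : R.IsCanonical) (hX : IsOpen X)
    (hk : ContDiffOn ℝ ∞ (fun x => (k x : T →L[ℝ] V)) X) : P.toTranslationGroup.Coincide R :=
  hP.isCanonical.coincide hcan (hP.motion.hasFrame hR) hR hX hk (hP.gamma_eq hR hX hk)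
    (hP.motion.gamma_eq hR hX hk)

theorem rot_apply_eq_iff (P : MotionGroup X T) (x : V) (t θ θ' : T) :
    P.rot x t θ = θ' ↔ θ = P.rotInv x t θ' := by
  have h1 := congrArg (fun A : T →L[ℝ] T => A θ) (P.rotInv_mul_rotL x t)
  have h2 := congrArg (fun A : T →L[ℝ] T => A θ') (P.rotL_mul_rotInv x t)
  constructor
  · rintro rfl
    exact h1.symm
  · rintro rfl
    exact h2

/-- The rotations of a group of parallel transports are the finite parallel transports along the
geodesics. -/
theorem IsParallelTransport.exists_parallel (hP : IsParallelTransport R P) (hR : R.HasFrame k)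
    (hX : IsOpen X) (hk : ContDiffOn ℝ ∞ (fun x => (k x : T →L[ℝ] V)) X) {x : V} {t : T}
    (ht : (x, t) ∈ P.dom) :
    ∃ τ : ℝ → T, τ 0 = t ∧
      (∀ s ∈ Set.Icc (0 : ℝ) 1, (x, s • t) ∈ P.dom ∧
        HasDerivAt (fun σ : ℝ => P.act x (σ • t)) (k (P.act x (s • t)) (τ s)) s ∧
        HasDerivAt τ (-R.gamma (P.act x (s • t)) (τ s) (τ s)) s) ∧
      ∀ θ : ℝ → T,
        (∀ s ∈ Set.Icc (0 : ℝ) 1, HasDerivWithinAt θ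
          (-R.gamma (P.act x (s • t)) (τ s) (θ s)) (Set.Icc 0 1) s) ↔
        (∀ s ∈ Set.Icc (0 : ℝ) 1, P.rot x (s • t) (θ s) = θ 0) := by
  obtain ⟨v, hv, hdom, hg, -, hB⟩ := hP.exists_geodesic hR hX hk ht
  have hγ : ∀ s ∈ Set.Icc (0 : ℝ) 1, ∀ l l', R.gamma (P.act x (s • t)) l l'
      = leviCivita k (P.act x (s • t)) l l' := fun s hs =>
    hP.motion.gamma_eq hR hX hk _ (hg s hs).1
  refine ⟨v, hv, fun s hs => ⟨hdom s hs, (hg s hs).2.1, ?_⟩, fun θ => ?_⟩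
  · rw [hγ s hs]; exact (hg s hs).2.2
  have h0 : P.rotInv x ((0 : ℝ) • t) (θ 0) = θ 0 := by
    simp [rotInv, P.rot_zero x (P.base_mem x t ht)]
  -- The model solution with initial value `θ 0`; each direction compares `θ` with it.
  have hBθ : ∀ s ∈ Set.Icc (0 : ℝ) 1, HasDerivWithinAt (fun s => P.rotInv x (s • t) (θ 0))
      (-(leviCivita k (P.act x (s • t)) (v s) (P.rotInv x (s • t) (θ 0)))) (Set.Icc 0 1) s :=
    fun s hs => (hB.hasDerivAt_apply hs (θ 0)).hasDerivWithinAt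
  constructor
  · intro h s hs
    rw [rot_apply_eq_iff]
    exact eqOn_of_parallel (k := k) (c := fun s => P.act x (s • t)) (v := v)
      (fun s hs => by rw [← hγ s hs]; exact h s hs) hBθ h0.symm hs
  · intro h s hs
    have h1 : ∀ s ∈ Set.Icc (0 : ℝ) 1, θ s = P.rotInv x (s • t) (θ 0) := fun s hs =>
      (rot_apply_eq_iff P x _ _ _).1 (h s hs)
    rw [hγ s hs]
    have h2 := (hBθ s hs).congr h1 (h1 s hs)
    rwa [← h1 s hs] at h2

/-- The direction `k τ` at `x'` is `DK_x(t)t`, which `DH_x` sends back to `t`: the equation only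
involves the radial derivative of `ϖ`. -/
theorem transportEq_iff (hP : P.toTranslationGroup.HasFrame k) (hR : R.HasFrame k) {x : V} {t : T}
    (ht : (x, t) ∈ P.dom) {ϖ : T → T →L[ℝ] T} (hϖ : DifferentiableAt ℝ ϖ t) :
    P.TransportEq R x ϖ t ↔ ∀ θ, fderiv ℝ ϖ t t θ =
      ϖ t (R.gamma (P.act x t) (P.endVelocity x t) θ) := by
  have hx' : P.act x t ∈ X := P.target_mem x t ht
  have hH : HasFDerivAt (fun y => P.H x (y - x)) (fderiv ℝ (P.H x) (P.K x t)) (P.act x t) := by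
    have h1 : HasFDerivAt (P.H x) (fderiv ℝ (P.H x) (P.K x t)) (P.act x t - x) := by
      rw [TranslationGroup.act, add_sub_cancel_left]
      exact TranslationGroup.hasFDerivAt_H (P.K_mem x t ht)
    have h2 : HasFDerivAt (fun y => y - x) (ContinuousLinearMap.id ℝ V) (P.act x t) :=
      (hasFDerivAt_id _).sub_const x
    exact h1.comp (P.act x t) h2
  have hϖ' : HasFDerivAt ϖ (fderiv ℝ ϖ t) (P.H x (P.act x t - x)) := by
    rw [TranslationGroup.act, add_sub_cancel_left, P.H_K x t ht]
    exact hϖ.hasFDerivAt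
  have h1 : fderiv ℝ (fun y => ϖ (P.H x (y - x))) (P.act x t)
      = (fderiv ℝ ϖ t).comp (fderiv ℝ (P.H x) (P.K x t)) := (hϖ'.comp (P.act x t) hH).fderiv
  have h2 : R.coeff (P.act x t) (P.endVelocity x t) = fderiv ℝ (P.K x) t t := by
    rw [hR _ hx', endVelocity, hP.coframe_eq hx']
    exact ContinuousLinearEquiv.apply_symm_apply _ _
  have h3 := TranslationGroup.fderiv_H_fderiv_K ht t
  rw [TransportEq, h1, h2]
  simp only [ContinuousLinearMap.comp_apply, h3]

/-- The ray of `st` runs along the ray of `t` at `s` times the speed. -/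
theorem endVelocity_smul (hP : P.toTranslationGroup.HasFrame k) {x : V} {t : T} {v : ℝ → T}
    {S : Set ℝ} (hg : IsGeodesicOn X k (fun s => P.act x (s • t)) v S) {s : ℝ} (hs : s ∈ S)
    (hst : (x, s • t) ∈ P.dom) : P.endVelocity x (s • t) = s • v s := by
  have hl : HasDerivAt (fun s : ℝ => s • t) t s := by
    simpa using (hasDerivAt_id s).smul_const t
  have h1 : HasDerivAt (fun s : ℝ => P.act x (s • t)) (fderiv ℝ (P.K x) (s • t) t) s :=
    ((TranslationGroup.hasFDerivAt_K hst).comp_hasDerivAt s hl).const_add x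
  rw [endVelocity, hP.coframe_eq (hg s hs).1, map_smul, map_smul, h1.unique (hg s hs).2.1,
    ContinuousLinearEquiv.symm_apply_apply]

/-- The rotations of a group of parallel transports are the unique solution of the first-order
transport equation. -/
theorem IsParallelTransport.transportEq_iff_eq (hP : IsParallelTransport R P)
    (hR : R.HasFrame k) (hX : IsOpen X)
    (hk : ContDiffOn ℝ ∞ (fun x => (k x : T →L[ℝ] V)) X) {x : V} (hx : x ∈ X)
    {ϖ : T → T →L[ℝ] T} (hϖ : DifferentiableOn ℝ ϖ {t | (x, t) ∈ P.dom}) :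
    (ϖ 0 = 1 ∧ ∀ t, (x, t) ∈ P.dom → P.TransportEq R x ϖ t) ↔
      ∀ t, (x, t) ∈ P.dom → ϖ t = P.rotL x t := by
  have hPF := hP.motion.hasFrame hR
  have hd : ∀ t, (x, t) ∈ P.dom → DifferentiableAt ℝ ϖ t := fun t ht =>
    hϖ.differentiableAt (TranslationGroup.eventually_mem_dom ht)
  have hl : ∀ (t : T) (s : ℝ), HasDerivAt (fun s : ℝ => s • t) t s := fun t s => by
    simpa using (hasDerivAt_id s).smul_const t
  constructor
  · rintro ⟨h0, h⟩ t ht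
    obtain ⟨v, hv, hdom, hg, -, hB⟩ := hP.exists_geodesic hR hX hk ht
    let f : ℝ → T →L[ℝ] T := fun s => (ϖ (s • t)).comp (P.rotInv x (s • t))
    have hϖd : ∀ s ∈ Set.Icc (0 : ℝ) 1,
        HasDerivAt (fun s : ℝ => ϖ (s • t)) (fderiv ℝ ϖ (s • t) t) s := fun s hs =>
      (hd _ (hdom s hs)).hasFDerivAt.comp_hasDerivAt s (hl t s)
    have hfc : ∀ s ∈ Set.Icc (0 : ℝ) 1, ContinuousAt f s := fun s hs =>
      ((hϖd s hs).clm_comp (hB s hs)).continuousAt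
    -- The radial equation at `st` carries a factor `s` on both sides, which can be cancelled only
    -- for `s > 0`. Constancy is therefore proved away from `0` and extended by continuity of `f`.
    have hf' : ∀ s ∈ Set.Icc (0 : ℝ) 1, 0 < s → HasDerivAt f 0 s := by
      intro s hs hs0
      refine ((hϖd s hs).clm_comp (hB s hs)).congr_deriv ?_
      have h1 : fderiv ℝ ϖ (s • t) t
          = (ϖ (s • t)).comp (leviCivita k (P.act x (s • t)) (v s)) := by
        ext θ
        have h2 := (transportEq_iff hPF hR (hdom s hs) (hd _ (hdom s hs))).1 (h _ (hdom s hs)) θ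
        rw [hP.motion.gamma_eq hR hX hk _ (hg s hs).1, endVelocity_smul hPF hg hs (hdom s hs)]
          at h2
        simp only [map_smul, smul_apply] at h2
        exact smul_right_injective T hs0.ne' h2
      rw [h1]
      ext θ
      simp
    have hconst : ∀ ε ∈ Set.Ioo (0 : ℝ) 1, f ε = f 1 := fun ε hε =>
      (constant_of_has_deriv_right_zero
        (fun s hs => (hfc s ⟨hε.1.le.trans hs.1, hs.2⟩).continuousWithinAt)
        (fun s hs => (hf' s ⟨hε.1.le.trans hs.1, hs.2.le⟩ (hε.1.trans_le hs.1)).hasDerivWithinAt)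
        1 (Set.right_mem_Icc.2 hε.2.le)).symm
    have hlim : Filter.Tendsto f (nhdsWithin 0 (Set.Ioi 0)) (nhds (f 0)) :=
      (hfc 0 (Set.left_mem_Icc.2 zero_le_one)).tendsto.mono_left nhdsWithin_le_nhds
    have h01 : f 0 = f 1 := tendsto_nhds_unique hlim
      (tendsto_const_nhds.congr' (Filter.mem_of_superset (Ioo_mem_nhdsGT zero_lt_one)
        fun ε hε => (hconst ε hε).symm))
    have hf0 : f 0 = 1 := by
      ext θ
      simp [f, h0, rotInv, P.rot_zero x hx]
    have hf1 : ϖ t * P.rotInv x t = 1 := by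
      rw [← hf0, h01]
      simp only [f, one_smul]; rfl
    calc ϖ t = ϖ t * (P.rotInv x t * P.rotL x t) := by rw [rotInv_mul_rotL, mul_one]
      _ = P.rotL x t := by rw [← mul_assoc, hf1, one_mul]
  · intro h
    refine ⟨(h 0 (P.zero_mem x hx)).trans (rotL_zero hx), fun t ht => ?_⟩
    rw [transportEq_iff hPF hR ht (hd t ht)]
    intro θ
    obtain ⟨v, hv, hdom, hg, hA, -⟩ := hP.exists_geodesic hR hX hk ht
    have h1m : (1 : ℝ) ∈ Set.Icc (0 : ℝ) 1 := Set.right_mem_Icc.2 zero_le_one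
    have h1 := hA 1 h1m
    have h2 : HasDerivAt (fun s : ℝ => P.rotL x (s • t)) (fderiv ℝ ϖ t t) 1 := by
      have h3 : HasFDerivAt (P.rotL x) (fderiv ℝ ϖ t) ((1 : ℝ) • t) := by
        rw [one_smul]
        exact (hd t ht).hasFDerivAt.congr_of_eventuallyEq
          ((TranslationGroup.eventually_mem_dom ht).mono fun t' ht' => (h t' ht').symm)
      exact h3.comp_hasDerivAt (1 : ℝ) (hl t 1)
    have h4 := endVelocity_smul hPF hg h1m (hdom 1 h1m)
    simp only [one_smul] at h1 h4
    rw [h2.unique h1, h t ht, h4, hP.motion.gamma_eq hR hX hk (P.act x t) (P.target_mem x t ht)]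
    rfl

end MotionGroup

end ParallelTransport

/-! ### The exponential map with parallel transport, and its local charts -/

section Exponential

variable {V : Type*} [NormedAddCommGroup V] [NormedSpace ℝ V] [FiniteDimensional ℝ V]
variable {T : Type*} [NormedAddCommGroup T] [InnerProductSpace ℝ T] [FiniteDimensional ℝ T]
variable {X : Set V} {k : V → T ≃L[ℝ] V}

/-- `c` is on `S` the geodesic from `x` with initial velocity `t`, and `B` the parallel transport
along it. -/
structure IsFrameFlow (X : Set V) (k : V → T ≃L[ℝ] V) (x : V) (t : T) (c : ℝ → V) (v : ℝ → T)
    (B : ℝ → T →L[ℝ] T) (S : Set ℝ) : Prop where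
  base : c 0 = x
  vel : v 0 = t
  one : B 0 = 1
  geodesic : IsGeodesicOn X k c v S
  transport : IsTransportOn k c v B S

/-- The vector field of the flow of geodesics and parallel transports. -/
noncomputable def frameField (k : V → T ≃L[ℝ] V) (z : V × T × (T →L[ℝ] T)) :
    V × T × (T →L[ℝ] T) :=
  (k z.1 z.2.1, -(leviCivita k z.1 z.2.1 z.2.1), -((leviCivita k z.1 z.2.1).comp z.2.2))

theorem contDiffOn_frameField (hX : IsOpen X)
    (hk : ContDiffOn ℝ ∞ (fun x => (k x : T →L[ℝ] V)) X) :
    ContDiffOn ℝ ∞ (frameField k) (X ×ˢ Set.univ) := by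
  have h1 : ContDiffOn ℝ ∞ (fun z : V × T × (T →L[ℝ] T) => z.1) (X ×ˢ Set.univ) := contDiffOn_fst
  have h2 : ContDiffOn ℝ ∞ (fun z : V × T × (T →L[ℝ] T) => z.2.1) (X ×ˢ Set.univ) :=
    (contDiff_fst.comp contDiff_snd).contDiffOn
  have h3 : ContDiffOn ℝ ∞ (fun z : V × T × (T →L[ℝ] T) => z.2.2) (X ×ˢ Set.univ) :=
    (contDiff_snd.comp contDiff_snd).contDiffOn
  have hL := ((contDiffOn_leviCivita hX hk).comp h1 fun p hp => hp.1).clm_apply h2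
  exact ((hk.comp h1 fun p hp => hp.1).clm_apply h2).prodMk
    ((hL.clm_apply h2).neg.prodMk (hL.clm_comp h3).neg)

/-- At zero velocity only variations of the velocity contribute, and the image has zero velocity
component. Hence the square vanishes, as `exists_contDiffOn_flow` requires. -/
theorem fderiv_frameField (hX : IsOpen X)
    (hk : ContDiffOn ℝ ∞ (fun x => (k x : T →L[ℝ] V)) X) {x : V} (hx : x ∈ X)
    (w : V × T × (T →L[ℝ] T)) :
    fderiv ℝ (frameField k) (x, 0, 1) w = (k x w.2.1, 0, -(leviCivita k x w.2.1)) := by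
  have h1 : HasFDerivAt (fun z : V × T × (T →L[ℝ] T) => z.1) (ContinuousLinearMap.fst ℝ _ _)
      (x, 0, 1) := hasFDerivAt_fst
  have h2 : HasFDerivAt (fun z : V × T × (T →L[ℝ] T) => z.2.1)
      ((ContinuousLinearMap.fst ℝ _ _).comp (ContinuousLinearMap.snd ℝ _ _)) (x, 0, 1) :=
    hasFDerivAt_fst.comp _ hasFDerivAt_snd
  have h3 : HasFDerivAt (fun z : V × T × (T →L[ℝ] T) => z.2.2)
      ((ContinuousLinearMap.snd ℝ _ _).comp (ContinuousLinearMap.snd ℝ _ _)) (x, 0, 1) :=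
    hasFDerivAt_snd.comp _ hasFDerivAt_snd
  have hk1 : HasFDerivAt (fun y => (k y : T →L[ℝ] V))
      (fderiv ℝ (fun y => (k y : T →L[ℝ] V)) x) x :=
    ((hk.contDiffAt (hX.mem_nhds hx)).differentiableAt (by simp)).hasFDerivAt
  have hl1 : HasFDerivAt (leviCivita k) (fderiv ℝ (leviCivita k) x) x :=
    (((contDiffOn_leviCivita hX hk).contDiffAt (hX.mem_nhds hx)).differentiableAt
      (by simp)).hasFDerivAt
  have hkz : HasFDerivAt (fun z : V × T × (T →L[ℝ] T) => (k z.1 : T →L[ℝ] V)) _ (x, 0, 1) :=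
    HasFDerivAt.comp (g := fun y => (k y : T →L[ℝ] V)) (x, (0 : T), (1 : T →L[ℝ] T)) hk1 h1
  have hlz : HasFDerivAt (fun z : V × T × (T →L[ℝ] T) => leviCivita k z.1) _ (x, 0, 1) :=
    HasFDerivAt.comp (g := leviCivita k) (x, (0 : T), (1 : T →L[ℝ] T)) hl1 h1
  have hL := hlz.clm_apply h2
  have h : HasFDerivAt (frameField k) _ (x, 0, 1) := (hkz.clm_apply h2).prodMk
    ((hL.clm_apply h2).neg.prodMk (hL.clm_comp h3).neg)
  rw [h.fderiv]
  refine Prod.ext ?_ (Prod.ext ?_ ?_)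
  · simp
  · simp
  · ext θ
    simp

theorem exists_local_frameFlow (hX : IsOpen X)
    (hk : ContDiffOn ℝ ∞ (fun x => (k x : T →L[ℝ] V)) X) {x₀ : V} (hx₀ : x₀ ∈ X) :
    ∃ r > 0, ∃ (c : V × T → ℝ → V) (v : V × T → ℝ → T) (B : V × T → ℝ → T →L[ℝ] T),
      ContDiffOn ℝ ∞ (fun p => (c p 1, B p 1)) (Metric.ball x₀ r ×ˢ Metric.ball 0 r) ∧
      ∀ p ∈ Metric.ball x₀ r ×ˢ Metric.ball (0 : T) r,
        IsFrameFlow X k p.1 p.2 (c p) (v p) (B p) (Set.Ioo (-2) 2) := by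
  obtain ⟨U, hU, hzU, y, hy, hyU⟩ := exists_contDiffOn_flow (hX.prod isOpen_univ)
    (contDiffOn_frameField hX hk) (z₀ := (x₀, 0, 1)) ⟨hx₀, Set.mem_univ _⟩
    (by simp [frameField])
    (fun w => by rw [fderiv_frameField hX hk hx₀, fderiv_frameField hX hk hx₀]; simp)
  let ι : V × T → V × T × (T →L[ℝ] T) := fun p => (p.1, p.2, 1)
  have hι : ContDiff ℝ ∞ ι := contDiff_fst.prodMk (contDiff_snd.prodMk contDiff_const)
  have hW : ι ⁻¹' U ∈ nhds (x₀, (0 : T)) :=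
    hι.continuous.continuousAt.preimage_mem_nhds (hU.mem_nhds hzU)
  obtain ⟨r, hr, hrW⟩ := Metric.mem_nhds_iff.1 hW
  rw [← ball_prod_same] at hrW
  refine ⟨r, hr, fun p s => (y (ι p) s).1, fun p s => (y (ι p) s).2.1,
    fun p s => (y (ι p) s).2.2, ?_, fun p hp => ?_⟩
  · have h1 : ContDiffOn ℝ ∞ (fun p => y (ι p) 1) (Metric.ball x₀ r ×ˢ Metric.ball 0 r) :=
      hy.comp hι.contDiffOn hrW
    exact (contDiff_fst.comp_contDiffOn h1).prodMk
      (contDiff_snd.comp_contDiffOn (contDiff_snd.comp_contDiffOn h1))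
  · obtain ⟨h0, hs⟩ := hyU _ (hrW hp)
    refine ⟨?_, ?_, ?_, fun s hs' => ?_, fun s hs' => ?_⟩
    · exact congrArg (fun z => z.1) h0
    · exact congrArg (fun z => z.2.1) h0
    · exact congrArg (fun z => z.2.2) h0
    · have hd := (hs s hs').2
      have h2 := (ContinuousLinearMap.snd ℝ V (T × (T →L[ℝ] T))).hasFDerivAt.comp_hasDerivAt s hd
      exact ⟨(hs s hs').1.1,
        (ContinuousLinearMap.fst ℝ V (T × (T →L[ℝ] T))).hasFDerivAt.comp_hasDerivAt s hd,
        (ContinuousLinearMap.fst ℝ T (T →L[ℝ] T)).hasFDerivAt.comp_hasDerivAt s h2⟩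
    · have hd := (hs s hs').2
      have h2 := (ContinuousLinearMap.snd ℝ V (T × (T →L[ℝ] T))).hasFDerivAt.comp_hasDerivAt s hd
      exact (ContinuousLinearMap.snd ℝ T (T →L[ℝ] T)).hasFDerivAt.comp_hasDerivAt s h2

/-- The end point of the geodesic from `x` with initial velocity `t`, and the parallel transport to
it. -/
noncomputable def frameExp (X : Set V) (k : V → T ≃L[ℝ] V) (x : V) (t : T) : V × (T →L[ℝ] T) :=
  Classical.epsilon fun p => ∃ c v B, IsFrameFlow X k x t c v B (Set.Icc 0 1) ∧ p = (c 1, B 1)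

namespace IsFrameFlow

variable {x : V} {t : T} {c : ℝ → V} {v : ℝ → T} {B : ℝ → T →L[ℝ] T}

/-- Uniqueness of geodesics and of transports makes the choice in `frameExp` immaterial. -/
theorem frameExp_eq (h : IsFrameFlow X k x t c v B (Set.Icc 0 1)) (hX : IsOpen X)
    (hk : ContDiffOn ℝ ∞ (fun x => (k x : T →L[ℝ] V)) X) : frameExp X k x t = (c 1, B 1) := by
  obtain ⟨c', v', B', h', he⟩ := Classical.epsilon_spec
    (p := fun p => ∃ c v B, IsFrameFlow X k x t c v B (Set.Icc 0 1) ∧ p = (c 1, B 1))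
    ⟨_, c, v, B, h, rfl⟩
  obtain ⟨h1, h2⟩ := h'.geodesic.eqOn hX hk h.geodesic (h'.base.trans h.base.symm)
    (h'.vel.trans h.vel.symm)
  have h3 := h'.transport.eqOn h.transport h1 h2 (h'.one.trans h.one.symm)
  have m : (1 : ℝ) ∈ Set.Icc (0 : ℝ) 1 := Set.right_mem_Icc.2 zero_le_one
  rw [frameExp, he, h1 m, h3 m]

theorem frameExp_smul (h : IsFrameFlow X k x t c v B (Set.Ioo (-2) 2)) (hX : IsOpen X)
    (hk : ContDiffOn ℝ ∞ (fun x => (k x : T →L[ℝ] V)) X) {s : ℝ} (hs : s ∈ Set.Ioo (-2 : ℝ) 2) :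
    frameExp X k x (s • t) = (c s, B s) := by
  have hm : ∀ σ ∈ Set.Icc (0 : ℝ) 1, 0 + s * σ ∈ Set.Ioo (-2 : ℝ) 2 := fun σ hσ => by
    obtain ⟨h1, h2⟩ := hσ
    obtain ⟨h3, h4⟩ := hs
    constructor <;> nlinarith
  have h' : IsFrameFlow X k x (s • t) (fun σ => c (0 + s * σ)) (fun σ => s • v (0 + s * σ))
      (fun σ => (B (0 + s * σ)).comp (1 : T →L[ℝ] T)) (Set.Icc 0 1) :=
    ⟨by simpa using h.base, by simp [h.vel], by ext θ; simp [h.one],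
      h.geodesic.comp_affine 0 s hm, h.transport.comp_affine 0 s 1 hm⟩
  rw [h'.frameExp_eq hX hk]
  refine Prod.ext (by simp) ?_
  ext θ
  simp

/-- The flow property, from which the group law will follow: restart at time `s`, with `A` inverting
`B s` so that the new transport begins at `1`. -/
theorem frameExp_add (h : IsFrameFlow X k x t c v B (Set.Ioo (-2) 2)) (hX : IsOpen X)
    (hk : ContDiffOn ℝ ∞ (fun x => (k x : T →L[ℝ] V)) X) {s s' : ℝ}
    (hs : s ∈ Set.Ioo (-2 : ℝ) 2) (hs' : s + s' ∈ Set.Ioo (-2 : ℝ) 2) {A : T →L[ℝ] T}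
    (hA : (B s).comp A = 1) :
    frameExp X k (c s) (s' • v s) = (c (s + s'), (B (s + s')).comp A) := by
  have hm : ∀ σ ∈ Set.Icc (0 : ℝ) 1, s + s' * σ ∈ Set.Ioo (-2 : ℝ) 2 := fun σ hσ => by
    have h1 := convex_Ioo (-2 : ℝ) 2 hs hs' (sub_nonneg.2 hσ.2) hσ.1 (by ring)
    simp only [smul_eq_mul] at h1
    convert h1 using 1
    ring
  have h' : IsFrameFlow X k (c s) (s' • v s) (fun σ => c (s + s' * σ))
      (fun σ => s' • v (s + s' * σ)) (fun σ => (B (s + s' * σ)).comp A) (Set.Icc 0 1) :=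
    ⟨by simp, by simp, by simpa using hA,
      h.geodesic.comp_affine s s' hm, h.transport.comp_affine s s' A hm⟩
  rw [h'.frameExp_eq hX hk]
  simp

theorem frameExp_zero (h : IsFrameFlow X k x t c v B (Set.Ioo (-2) 2)) (hX : IsOpen X)
    (hk : ContDiffOn ℝ ∞ (fun x => (k x : T →L[ℝ] V)) X) : frameExp X k x 0 = (x, 1) := by
  have h1 := h.frameExp_smul hX hk (s := 0) (by norm_num)
  rwa [zero_smul, h.base, h.one] at h1

theorem norm_frameExp (h : IsFrameFlow X k x t c v B (Set.Ioo (-2) 2)) (hX : IsOpen X)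
    (hk : ContDiffOn ℝ ∞ (fun x => (k x : T →L[ℝ] V)) X) (θ : T) :
    ‖(frameExp X k x t).2 θ‖ = ‖θ‖ := by
  have h1 := h.frameExp_smul hX hk (s := 1) (by norm_num)
  rw [one_smul] at h1
  have hsub : Set.Icc (0 : ℝ) 1 ⊆ Set.Ioo (-2) 2 := fun s hs =>
    ⟨by linarith [hs.1], by linarith [hs.2]⟩
  have h2 : IsTransportOn k c v B (Set.Icc 0 1) := fun s hs => h.transport s (hsub hs)
  rw [h1, h2.norm_apply (Set.right_mem_Icc.2 zero_le_one), h.one]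
  rfl

end IsFrameFlow

/-- Small directions determine a linear map by homogeneity; geodesics are only available for those.
-/
theorem fderiv_zero_eq_of_rays {E F : Type*} [NormedAddCommGroup E] [NormedSpace ℝ E]
    [NormedAddCommGroup F] [NormedSpace ℝ F] {f : E → F} (hf : DifferentiableAt ℝ f 0)
    {L : E →L[ℝ] F}
    (h : ∀ᶠ l in nhds (0 : E), HasDerivAt (fun s : ℝ => f (s • l)) (L l) 0) :
    fderiv ℝ f 0 = L := by
  have h1 : ∀ᶠ l in nhds (0 : E), fderiv ℝ f 0 l = L l := by
    filter_upwards [h] with l hl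
    have h2 : HasFDerivAt f (fderiv ℝ f 0) ((0 : ℝ) • l) := by
      rw [zero_smul]; exact hf.hasFDerivAt
    have h3 : HasDerivAt (fun s : ℝ => s • l) l 0 := by
      simpa using (hasDerivAt_id (0 : ℝ)).smul_const l
    exact (h2.comp_hasDerivAt (0 : ℝ) h3).unique hl
  ext l
  have h4 : ContinuousAt (fun a : ℝ => a • l) 0 := by fun_prop
  have h5 : ∀ᶠ a in nhds (0 : ℝ), fderiv ℝ f 0 (a • l) = L (a • l) :=
    h4.eventually (p := fun y => fderiv ℝ f 0 y = L y) (by beta_reduce; rwa [zero_smul])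
  have h6 : ∀ᶠ a in nhdsWithin (0 : ℝ) (Set.Ioi 0), a ≠ 0 :=
    Filter.mem_of_superset self_mem_nhdsWithin fun a ha => ne_of_gt ha
  obtain ⟨a, ha, ha0⟩ := ((h5.filter_mono nhdsWithin_le_nhds).and h6).exists
  rw [map_smul, map_smul] at ha
  exact smul_right_injective F ha0 ha

/-- A radius such that the exponential map, with parallel transport, is well-behaved on the
product of balls of this radius. -/
structure IsNormalRadius (X : Set V) (k : V → T ≃L[ℝ] V) (x₀ : V) (r : ℝ) : Prop where
  pos : 0 < r
  flow : ∀ p ∈ Metric.ball x₀ r ×ˢ Metric.ball (0 : T) r, ∃ c v B,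
    IsFrameFlow X k p.1 p.2 c v B (Set.Ioo (-2) 2)
  smooth : ContDiffOn ℝ ∞ (fun p : V × T => frameExp X k p.1 p.2)
    (Metric.ball x₀ r ×ˢ Metric.ball 0 r)
  chart : ∃ e : OpenPartialHomeomorph (V × T) (V × V),
    (∀ p, e p = (p.1, (frameExp X k p.1 p.2).1 - p.1)) ∧
    Metric.ball x₀ r ×ˢ Metric.ball 0 r ⊆ e.source ∧ ContDiffOn ℝ ∞ e.symm e.target

/-- At `(x₀, 0)` the map `(x, t) ↦ (x, exp_x(t) - x)` has derivative `(id, k_{x₀})`: zero velocity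
fixes every point, and rays start with velocity `k_{x₀} t`. Inverting in both variables jointly
gives an inverse smooth in both. -/
theorem exists_isNormalRadius (hX : IsOpen X)
    (hk : ContDiffOn ℝ ∞ (fun x => (k x : T →L[ℝ] V)) X) {x₀ : V} (hx₀ : x₀ ∈ X) :
    ∃ r, IsNormalRadius X k x₀ r := by
  obtain ⟨r, hr, c, v, B, hsm, hfl⟩ := exists_local_frameFlow hX hk hx₀
  set box : Set (V × T) := Metric.ball x₀ r ×ˢ Metric.ball 0 r with hbox
  have hbo : IsOpen box := Metric.isOpen_ball.prod Metric.isOpen_ball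
  have h0 : (x₀, (0 : T)) ∈ box := ⟨Metric.mem_ball_self hr, Metric.mem_ball_self hr⟩
  have hexp : ContDiffOn ℝ ∞ (fun p : V × T => frameExp X k p.1 p.2) box := by
    refine hsm.congr fun p hp => ?_
    have h1 := (hfl p hp).frameExp_smul hX hk (s := 1) (by norm_num)
    rwa [one_smul] at h1
  let Θ : V × T → V × V := fun p => (p.1, (frameExp X k p.1 p.2).1 - p.1)
  have hΘ : ContDiffOn ℝ ∞ Θ box :=
    contDiffOn_fst.prodMk ((contDiff_fst.comp_contDiffOn hexp).sub contDiffOn_fst)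
  have hΘd : DifferentiableAt ℝ (fun p : V × T => (frameExp X k p.1 p.2).1 - p.1) (x₀, 0) :=
    (((contDiff_fst.comp_contDiffOn hexp).sub contDiffOn_fst).contDiffAt
      (hbo.mem_nhds h0)).differentiableAt (by simp)
  set D := fderiv ℝ (fun p : V × T => (frameExp X k p.1 p.2).1 - p.1) (x₀, 0) with hD
  have hD1 : D.comp (ContinuousLinearMap.inl ℝ V T) = 0 := by
    have h1 : HasFDerivAt (fun x : V => (x, (0 : T))) (ContinuousLinearMap.inl ℝ V T) x₀ :=
      (ContinuousLinearMap.inl ℝ V T).hasFDerivAt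
    have h2 : HasFDerivAt (fun x : V => (frameExp X k x 0).1 - x)
        (D.comp (ContinuousLinearMap.inl ℝ V T)) x₀ :=
      HasFDerivAt.comp (g := fun p : V × T => (frameExp X k p.1 p.2).1 - p.1) x₀
        hΘd.hasFDerivAt h1
    refine h2.unique ((hasFDerivAt_const (0 : V) x₀).congr_of_eventuallyEq ?_)
    filter_upwards [Metric.ball_mem_nhds x₀ hr] with x hx
    rw [(hfl (x, 0) ⟨hx, Metric.mem_ball_self hr⟩).frameExp_zero hX hk, sub_self]
  have hD2 : D.comp (ContinuousLinearMap.inr ℝ V T) = (k x₀ : T →L[ℝ] V) := by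
    have h1 : HasFDerivAt (fun t : T => (x₀, t)) (ContinuousLinearMap.inr ℝ V T) 0 :=
      (hasFDerivAt_const (𝕜 := ℝ) x₀ (0 : T)).prodMk (hasFDerivAt_id (𝕜 := ℝ) (0 : T))
    have h2 : HasFDerivAt (fun t : T => (frameExp X k x₀ t).1 - x₀)
        (D.comp (ContinuousLinearMap.inr ℝ V T)) 0 :=
      HasFDerivAt.comp (g := fun p : V × T => (frameExp X k p.1 p.2).1 - p.1) (0 : T)
        hΘd.hasFDerivAt h1
    rw [← h2.fderiv]
    refine fderiv_zero_eq_of_rays h2.differentiableAt ?_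
    filter_upwards [Metric.ball_mem_nhds (0 : T) hr] with l hl
    have hF := hfl (x₀, l) ⟨Metric.mem_ball_self hr, hl⟩
    have h3 := (hF.geodesic 0 (by norm_num)).2.1
    rw [hF.base, hF.vel] at h3
    refine (h3.sub_const x₀).congr_of_eventuallyEq ?_
    filter_upwards [Ioo_mem_nhds (show (-2 : ℝ) < 0 by norm_num) (show (0 : ℝ) < 2 by norm_num)]
      with s hs
    rw [hF.frameExp_smul hX hk hs]
  let L : (V × T) ≃L[ℝ] (V × V) := (ContinuousLinearEquiv.refl ℝ V).prodCongr (k x₀)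
  have hL : HasFDerivAt Θ (L : V × T →L[ℝ] V × V) (x₀, 0) := by
    refine (hasFDerivAt_fst.prodMk hΘd.hasFDerivAt).congr_fderiv ?_
    refine ContinuousLinearMap.ext fun w => Prod.ext rfl ?_
    have h1 := congrArg (fun A : V →L[ℝ] V => A w.1) hD1
    have h2 := congrArg (fun A : T →L[ℝ] V => A w.2) hD2
    have h3 : D w = D (w.1, 0) + D (0, w.2) := by rw [← map_add]; simp
    change D w = k x₀ w.2
    rw [h3]
    change D (w.1, 0) = 0 at h1
    change D (0, w.2) = k x₀ w.2 at h2
    rw [h1, h2, zero_add]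
  obtain ⟨e, he, hsrc, hsub, hsymm⟩ := exists_openPartialHomeomorph_of_contDiffOn hbo hΘ h0 L hL
  obtain ⟨ρ, hρ, hρe⟩ := Metric.mem_nhds_iff.1 (e.open_source.mem_nhds hsrc)
  rw [← ball_prod_same] at hρe
  exact ⟨ρ, hρ, fun p hp => ⟨_, _, _, hfl p (hsub (hρe hp))⟩,
    hexp.mono (hρe.trans hsub), e, he, hρe, hsymm⟩

end Exponential

/-! ### The group of parallel transports built from the exponential map -/

section ExponentialGroup

variable {V : Type*} [NormedAddCommGroup V] [NormedSpace ℝ V] [FiniteDimensional ℝ V]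
variable {T : Type*} [NormedAddCommGroup T] [InnerProductSpace ℝ T] [FiniteDimensional ℝ T]
variable {X : Set V} {k : V → T ≃L[ℝ] V}

open Classical in
/-- The inverse of an isometric endomorphism, as an isometry (`1` if it is not isometric). -/
noncomputable def isometryInv (B : T →L[ℝ] T) : T ≃ₗᵢ[ℝ] T :=
  if h : ∀ θ, ‖B θ‖ = ‖θ‖ then
    (LinearIsometry.toLinearIsometryEquiv ⟨B.toLinearMap, h⟩ rfl).symm
  else 1

theorem isometryInv_apply {B : T →L[ℝ] T} (h : ∀ θ, ‖B θ‖ = ‖θ‖) (θ : T) :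
    isometryInv B (B θ) = θ := by
  rw [isometryInv, dif_pos h]
  exact LinearIsometryEquiv.symm_apply_apply
    (LinearIsometry.toLinearIsometryEquiv ⟨B.toLinearMap, h⟩ rfl) θ

theorem apply_isometryInv {B : T →L[ℝ] T} (h : ∀ θ, ‖B θ‖ = ‖θ‖) (θ : T) :
    B (isometryInv B θ) = θ := by
  rw [isometryInv, dif_pos h]
  exact LinearIsometryEquiv.apply_symm_apply
    (LinearIsometry.toLinearIsometryEquiv ⟨B.toLinearMap, h⟩ rfl) θ

/-- An isometric endomorphism as a unit of the ring of endomorphisms. -/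
noncomputable def isometryUnit (B : T →L[ℝ] T) (h : ∀ θ, ‖B θ‖ = ‖θ‖) : (T →L[ℝ] T)ˣ where
  val := B
  inv := ((isometryInv B).toContinuousLinearEquiv : T →L[ℝ] T)
  val_inv := by ext θ; exact apply_isometryInv h θ
  inv_val := by ext θ; exact isometryInv_apply h θ

/-- This form makes the smoothness of inversion in a Banach algebra applicable to the rotations. -/
theorem isometryInv_eq_inverse {B : T →L[ℝ] T} (h : ∀ θ, ‖B θ‖ = ‖θ‖) :
    ((isometryInv B).toContinuousLinearEquiv : T →L[ℝ] T) = Ring.inverse B :=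
  (Ring.inverse_unit (isometryUnit B h)).symm

theorem isometryInv_one : isometryInv (1 : T →L[ℝ] T) = 1 := by
  ext θ
  exact isometryInv_apply (B := 1) (fun _ => rfl) θ

/-- A radius of validity of the exponential map at `x₀`. -/
noncomputable def normalRadius (X : Set V) (k : V → T ≃L[ℝ] V) (x₀ : V) : ℝ :=
  Classical.epsilon (IsNormalRadius X k x₀)

theorem isNormalRadius_normalRadius (hX : IsOpen X)
    (hk : ContDiffOn ℝ ∞ (fun x => (k x : T →L[ℝ] V)) X) {x₀ : V} (hx₀ : x₀ ∈ X) :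
    IsNormalRadius X k x₀ (normalRadius X k x₀) :=
  Classical.epsilon_spec (exists_isNormalRadius hX hk hx₀)

/-- The product of balls of validity of the exponential map at `x₀`. -/
def normalBox (X : Set V) (k : V → T ≃L[ℝ] V) (x₀ : V) : Set (V × T) :=
  Metric.ball x₀ (normalRadius X k x₀) ×ˢ Metric.ball 0 (normalRadius X k x₀)

/-- The domain of the group of parallel transports. -/
def expDom (X : Set V) (k : V → T ≃L[ℝ] V) : Set (V × T) :=
  {p | ∃ x₀ ∈ X, p ∈ normalBox X k x₀}

/-- The deformation map of the group of parallel transports. -/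
noncomputable def expMap (X : Set V) (k : V → T ≃L[ℝ] V) (x : V) (t : T) : V :=
  (frameExp X k x t).1 - x

/-- The range of the deformation map of the group of parallel transports. -/
def expRng (X : Set V) (k : V → T ≃L[ℝ] V) : Set (V × V) :=
  (fun p : V × T => (p.1, expMap X k p.1 p.2)) '' expDom X k

/-- The inverse of the deformation map of the group of parallel transports. -/
noncomputable def logMap (X : Set V) (k : V → T ≃L[ℝ] V) (x u : V) : T :=
  Function.invFunOn (expMap X k x) {t | (x, t) ∈ expDom X k} u

theorem isOpen_normalBox (x₀ : V) : IsOpen (normalBox X k x₀) :=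
  Metric.isOpen_ball.prod Metric.isOpen_ball

theorem isOpen_expDom : IsOpen (expDom X k) := by
  have h : expDom X k = ⋃ x₀ ∈ X, normalBox X k x₀ := by ext p; simp [expDom]
  rw [h]
  exact isOpen_biUnion fun x₀ _ => isOpen_normalBox x₀

theorem exists_frameFlow_of_mem (hX : IsOpen X)
    (hk : ContDiffOn ℝ ∞ (fun x => (k x : T →L[ℝ] V)) X) {x : V} {t : T}
    (h : (x, t) ∈ expDom X k) :
    ∃ c v B, IsFrameFlow X k x t c v B (Set.Ioo (-2) 2) := by
  obtain ⟨x₀, hx₀, hp⟩ := h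
  exact (isNormalRadius_normalRadius hX hk hx₀).flow (x, t) hp

theorem zero_mem_expDom (hX : IsOpen X)
    (hk : ContDiffOn ℝ ∞ (fun x => (k x : T →L[ℝ] V)) X) {x : V} (hx : x ∈ X) :
    (x, (0 : T)) ∈ expDom X k := by
  have h := (isNormalRadius_normalRadius hX hk hx).pos
  exact ⟨x, hx, Metric.mem_ball_self h, Metric.mem_ball_self h⟩

theorem contDiffOn_frameExp (hX : IsOpen X)
    (hk : ContDiffOn ℝ ∞ (fun x => (k x : T →L[ℝ] V)) X) :
    ContDiffOn ℝ ∞ (fun p : V × T => frameExp X k p.1 p.2) (expDom X k) := by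
  rintro p ⟨x₀, hx₀, hp⟩
  exact ((isNormalRadius_normalRadius hX hk hx₀).smooth.contDiffAt
    ((isOpen_normalBox x₀).mem_nhds hp)).contDiffWithinAt

theorem contDiffOn_expMap (hX : IsOpen X)
    (hk : ContDiffOn ℝ ∞ (fun x => (k x : T →L[ℝ] V)) X) :
    ContDiffOn ℝ ∞ (fun p : V × T => expMap X k p.1 p.2) (expDom X k) :=
  (contDiff_fst.comp_contDiffOn (contDiffOn_frameExp hX hk)).sub contDiffOn_fst

/-- All parameter balls are centred at `0`, so over a fixed `x` two of them are nested and both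
parameters lie in the box of larger radius, whose chart is injective. -/
theorem injOn_expMap (hX : IsOpen X)
    (hk : ContDiffOn ℝ ∞ (fun x => (k x : T →L[ℝ] V)) X) (x : V) :
    Set.InjOn (expMap X k x) {t | (x, t) ∈ expDom X k} := by
  have key : ∀ x₀ ∈ X, ∀ t t', (x, t) ∈ normalBox X k x₀ → (x, t') ∈ normalBox X k x₀ →
      expMap X k x t = expMap X k x t' → t = t' := by
    intro x₀ hx₀ t t' ht ht' h
    obtain ⟨e, he, hsub, -⟩ := (isNormalRadius_normalRadius hX hk hx₀).chart
    have h1 := e.injOn (hsub ht) (hsub ht') (by rw [he, he]; exact Prod.ext rfl h)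
    exact congrArg Prod.snd h1
  rintro t ⟨x₀, hx₀, h1, h2⟩ t' ⟨x₁, hx₁, h1', h2'⟩ h
  rcases le_total (normalRadius X k x₀) (normalRadius X k x₁) with hle | hle
  · exact key x₁ hx₁ t t' ⟨h1', Metric.ball_subset_ball hle h2⟩ ⟨h1', h2'⟩ h
  · exact key x₀ hx₀ t t' ⟨h1, h2⟩ ⟨h1, Metric.ball_subset_ball hle h2'⟩ h

theorem logMap_expMap (hX : IsOpen X)
    (hk : ContDiffOn ℝ ∞ (fun x => (k x : T →L[ℝ] V)) X) {x : V} {t : T}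
    (h : (x, t) ∈ expDom X k) : logMap X k x (expMap X k x t) = t :=
  (injOn_expMap hX hk x).leftInvOn_invFunOn h

theorem exists_chart (hX : IsOpen X)
    (hk : ContDiffOn ℝ ∞ (fun x => (k x : T →L[ℝ] V)) X) {p : V × T} (hp : p ∈ expDom X k) :
    ∃ e : OpenPartialHomeomorph (V × T) (V × V), p ∈ e.source ∧ e.source ⊆ expDom X k ∧
      (∀ p, e p = (p.1, expMap X k p.1 p.2)) ∧ ContDiffOn ℝ ∞ e.symm e.target := by
  obtain ⟨x₀, hx₀, hpb⟩ := hp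
  obtain ⟨e, he, hsub, hsm⟩ := (isNormalRadius_normalRadius hX hk hx₀).chart
  refine ⟨e.restrOpen _ (isOpen_normalBox (X := X) (k := k) x₀), ⟨hsub hpb, hpb⟩,
    fun q hq => ⟨x₀, hx₀, hq.2⟩, he, ?_⟩
  exact hsm.mono fun q hq => hq.1

theorem isOpen_expRng (hX : IsOpen X)
    (hk : ContDiffOn ℝ ∞ (fun x => (k x : T →L[ℝ] V)) X) : IsOpen (expRng X k) := by
  rw [isOpen_iff_mem_nhds]
  rintro _ ⟨p, hp, rfl⟩
  obtain ⟨e, hpe, hsub, he, -⟩ := exists_chart hX hk hp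
  have h1 := e.open_target.mem_nhds (e.map_source hpe)
  rw [he] at h1
  refine Filter.mem_of_superset h1 fun q hq => ⟨e.symm q, hsub (e.map_target hq), ?_⟩
  have h2 := e.right_inv hq
  rwa [he] at h2

theorem contDiffOn_logMap (hX : IsOpen X)
    (hk : ContDiffOn ℝ ∞ (fun x => (k x : T →L[ℝ] V)) X) :
    ContDiffOn ℝ ∞ (fun p : V × V => logMap X k p.1 p.2) (expRng X k) := by
  rintro _ ⟨p, hp, rfl⟩
  obtain ⟨e, hpe, hsub, he, hsm⟩ := exists_chart hX hk hp
  have h1 := e.open_target.mem_nhds (e.map_source hpe)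
  rw [he] at h1
  refine ContDiffAt.contDiffWithinAt ?_
  refine ((contDiff_snd.comp_contDiffOn hsm).contDiffAt h1).congr_of_eventuallyEq ?_
  filter_upwards [h1] with q hq
  have h2 := e.right_inv hq
  rw [he] at h2
  have h3 : logMap X k (e.symm q).1 (expMap X k (e.symm q).1 (e.symm q).2) = (e.symm q).2 :=
    logMap_expMap hX hk (hsub (e.map_target hq))
  have h4 := congrArg Prod.fst h2
  have h5 := congrArg Prod.snd h2
  simp only at h4 h5
  rw [h5, h4] at h3
  exact h3

/-- The group of parallel transports of a frame field, given by the exponential map and the parallel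
transport along geodesics. -/
noncomputable def expGroup (hX : IsOpen X)
    (hk : ContDiffOn ℝ ∞ (fun x => (k x : T →L[ℝ] V)) X) : MotionGroup X T where
  K := expMap X k
  H := logMap X k
  dom := expDom X k
  rng := expRng X k
  isOpen_dom := isOpen_expDom
  isOpen_rng := isOpen_expRng hX hk
  zero_mem := fun _ hx => zero_mem_expDom hX hk hx
  K_zero := fun x hx => by
    obtain ⟨c, v, B, h⟩ := exists_frameFlow_of_mem hX hk (zero_mem_expDom hX hk hx)
    rw [expMap, h.frameExp_zero hX hk, sub_self]
  base_mem := fun x t ht => by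
    obtain ⟨c, v, B, h⟩ := exists_frameFlow_of_mem hX hk ht
    rw [← h.base]
    exact (h.geodesic 0 (by norm_num)).1
  target_mem := fun x t ht => by
    obtain ⟨c, v, B, h⟩ := exists_frameFlow_of_mem hX hk ht
    have h1 := h.frameExp_smul hX hk (s := 1) (by norm_num)
    rw [one_smul] at h1
    rw [expMap, h1, add_sub_cancel]
    exact (h.geodesic 1 (by norm_num)).1
  K_mem := fun x t ht => ⟨(x, t), ht, rfl⟩
  H_mem := by
    rintro x u ⟨⟨y, t⟩, ht, he⟩
    obtain ⟨rfl, rfl⟩ := Prod.ext_iff.1 he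
    rw [logMap_expMap hX hk ht]
    exact ht
  H_K := fun x t ht => logMap_expMap hX hk ht
  K_H := by
    rintro x u ⟨⟨y, t⟩, ht, he⟩
    obtain ⟨rfl, rfl⟩ := Prod.ext_iff.1 he
    rw [logMap_expMap hX hk ht]
  smooth_K := contDiffOn_expMap hX hk
  smooth_H := contDiffOn_logMap hX hk
  -- `π_x(t)` brings vectors at the end point back to `x`, so it is the inverse of the transport.
  rot := fun x t => isometryInv (frameExp X k x t).2
  rot_zero := fun x hx => by
    obtain ⟨c, v, B, h⟩ := exists_frameFlow_of_mem hX hk (zero_mem_expDom hX hk hx)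
    rw [h.frameExp_zero hX hk, isometryInv_one]
  smooth_rot := by
    have hiso : ∀ p ∈ expDom X k, ∀ θ, ‖(frameExp X k p.1 p.2).2 θ‖ = ‖θ‖ := fun p hp => by
      obtain ⟨c, v, B, h⟩ := exists_frameFlow_of_mem hX hk hp
      exact h.norm_frameExp hX hk
    have h2 : ContDiffOn ℝ ∞ (fun p : V × T => (frameExp X k p.1 p.2).2) (expDom X k) :=
      contDiff_snd.comp_contDiffOn (contDiffOn_frameExp hX hk)
    intro p hp
    have h3 : ContDiffAt ℝ ∞ Ring.inverse (frameExp X k p.1 p.2).2 :=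
      contDiffAt_ringInverse ℝ (isometryUnit _ (hiso p hp))
    have h4 : ContDiffWithinAt ℝ ∞ (fun q : V × T => Ring.inverse (frameExp X k q.1 q.2).2)
        (expDom X k) p := ContDiffAt.comp_contDiffWithinAt (g := Ring.inverse) p h3 (h2 p hp)
    exact h4.congr
      (fun q hq => isometryInv_eq_inverse (hiso q hq)) (isometryInv_eq_inverse (hiso p hp))

theorem norm_frameExp_of_mem (hX : IsOpen X)
    (hk : ContDiffOn ℝ ∞ (fun x => (k x : T →L[ℝ] V)) X) {x : V} {t : T}
    (ht : (x, t) ∈ expDom X k) (θ : T) : ‖(frameExp X k x t).2 θ‖ = ‖θ‖ := by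
  obtain ⟨c, v, B, h⟩ := exists_frameFlow_of_mem hX hk ht
  exact h.norm_frameExp hX hk θ

theorem expGroup_rotL (hX : IsOpen X)
    (hk : ContDiffOn ℝ ∞ (fun x => (k x : T →L[ℝ] V)) X) {x : V} {t : T}
    (ht : (x, t) ∈ expDom X k) :
    (expGroup hX hk).rotL x t = Ring.inverse (frameExp X k x t).2 :=
  isometryInv_eq_inverse (norm_frameExp_of_mem hX hk ht)

theorem expGroup_act (hX : IsOpen X)
    (hk : ContDiffOn ℝ ∞ (fun x => (k x : T →L[ℝ] V)) X) (x : V) (t : T) :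
    (expGroup hX hk).act x t = (frameExp X k x t).1 :=
  add_sub_cancel x _

/-- The frame of the group of parallel transports. -/
theorem expGroup_hasFrame (hX : IsOpen X)
    (hk : ContDiffOn ℝ ∞ (fun x => (k x : T →L[ℝ] V)) X) :
    (expGroup hX hk).toTranslationGroup.HasFrame k := by
  intro x hx
  have h0 : (x, (0 : T)) ∈ (expGroup hX hk).dom := zero_mem_expDom hX hk hx
  refine fderiv_zero_eq_of_rays (TranslationGroup.hasFDerivAt_K h0).differentiableAt ?_
  filter_upwards [TranslationGroup.eventually_mem_dom h0] with l hl
  obtain ⟨c, v, B, h⟩ := exists_frameFlow_of_mem hX hk hl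
  have h3 := (h.geodesic 0 (by norm_num)).2.1
  rw [h.base, h.vel] at h3
  refine (h3.sub_const x).congr_of_eventuallyEq ?_
  filter_upwards [Ioo_mem_nhds (show (-2 : ℝ) < 0 by norm_num) (show (0 : ℝ) < 2 by norm_num)]
    with s hs
  change (frameExp X k x (s • l)).1 - x = c s - x
  rw [h.frameExp_smul hX hk hs]

/-- Along a ray the transport starts with derivative `-γ_x(l)`, and inversion at `1` reverses the
sign. -/
theorem expGroup_fderiv_rotL (hX : IsOpen X)
    (hk : ContDiffOn ℝ ∞ (fun x => (k x : T →L[ℝ] V)) X) {x : V} (hx : x ∈ X) :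
    fderiv ℝ ((expGroup hX hk).rotL x) 0 = leviCivita k x := by
  have h0 : (x, (0 : T)) ∈ (expGroup hX hk).dom := zero_mem_expDom hX hk hx
  refine fderiv_zero_eq_of_rays (MotionGroup.differentiableAt_rotL h0) ?_
  filter_upwards [TranslationGroup.eventually_mem_dom h0] with l hl
  obtain ⟨c, v, B, h⟩ := exists_frameFlow_of_mem hX hk hl
  have h3 := h.transport 0 (by norm_num)
  rw [h.base, h.vel, h.one] at h3
  have h4 : HasFDerivAt (𝕜 := ℝ) Ring.inverse
      (-ContinuousLinearMap.mulLeftRight ℝ (T →L[ℝ] T) 1 1) (B 0) := by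
    rw [h.one]
    simpa using hasFDerivAt_ringInverse (𝕜 := ℝ) (1 : (T →L[ℝ] T)ˣ)
  have h5 := h4.comp_hasDerivAt (0 : ℝ) h3
  refine (h5.congr_of_eventuallyEq ?_).congr_deriv (by ext θ; simp)
  have hline : ContinuousAt (fun s : ℝ => s • l) 0 := by fun_prop
  have h6 : ∀ᶠ s in nhds (0 : ℝ), (x, s • l) ∈ (expGroup hX hk).dom :=
    hline.eventually (p := fun t => (x, t) ∈ (expGroup hX hk).dom)
      (by beta_reduce; rw [zero_smul]; exact TranslationGroup.eventually_mem_dom h0)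
  filter_upwards [h6, Ioo_mem_nhds (show (-2 : ℝ) < 0 by norm_num) (show (0 : ℝ) < 2 by norm_num)]
    with s hs1 hs2
  rw [expGroup_rotL hX hk hs1, h.frameExp_smul hX hk hs2]
  rfl

/-- The geodesics through `x` are the canonical curves of the group of parallel transports. -/
theorem expGroup_exists_canonicalCurve (hX : IsOpen X)
    (hk : ContDiffOn ℝ ∞ (fun x => (k x : T →L[ℝ] V)) X) {x : V} {t : T}
    (ht : (x, t) ∈ expDom X k) :
    ∃ (c : ℝ → V) (a b : ℝ), (expGroup hX hk).IsCanonicalCurve x c a b ∧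
      (1 : ℝ) ∈ Set.Ioo a b ∧ c 1 = (expGroup hX hk).act x t ∧
      (expGroup hX hk).velocity c 0 = t ∧
      HasDerivAt ((expGroup hX hk).velocity c) (-(leviCivita k x t t)) 0 := by
  obtain ⟨c, v, B, h⟩ := exists_frameFlow_of_mem hX hk ht
  obtain ⟨x₀, hx₀, h1, h2⟩ := id ht
  set r := normalRadius X k x₀
  simp only [mem_ball_zero_iff] at h2
  -- The strict bound `‖t‖ < r` leaves room for `b > 1`, which makes `1` an interior time. On `(-1,
  -- b)` one has `|s| ≤ b`, so `st` stays in the ball.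
  obtain ⟨b, hb1, hb2, hbr⟩ : ∃ b : ℝ, 1 < b ∧ b ≤ 2 ∧ b * ‖t‖ < r := by
    have hcont : ContinuousAt (fun b : ℝ => b * ‖t‖) 1 := by fun_prop
    have h3 : ∀ᶠ b in nhds (1 : ℝ), b * ‖t‖ < r :=
      hcont.eventually_lt continuousAt_const (by simpa using h2)
    have h4 : ∀ᶠ b in nhdsWithin (1 : ℝ) (Set.Ioi 1), b ∈ Set.Ioo (1 : ℝ) 2 :=
      Ioo_mem_nhdsGT (by norm_num)
    obtain ⟨b, hb, hb'⟩ := ((h3.filter_mono nhdsWithin_le_nhds).and h4).exists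
    exact ⟨b, hb'.1, hb'.2.le, hb⟩
  have hsub : Set.Ioo (-1) b ⊆ Set.Ioo (-2 : ℝ) 2 := fun s hs =>
    ⟨by linarith [hs.1], by linarith [hs.2]⟩
  have hmem : ∀ s ∈ Set.Ioo (-1) b, (x, s • t) ∈ expDom X k := by
    intro s hs
    refine ⟨x₀, hx₀, h1, ?_⟩
    rw [mem_ball_zero_iff, norm_smul, Real.norm_eq_abs]
    refine lt_of_le_of_lt (mul_le_mul_of_nonneg_right ?_ (norm_nonneg t)) hbr
    exact abs_le.2 ⟨by linarith [hs.1], hs.2.le⟩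
  have hact : ∀ s ∈ Set.Ioo (-1) b, (expGroup hX hk).act x (s • t) = c s := fun s hs => by
    rw [expGroup_act, h.frameExp_smul hX hk (hsub hs)]
  have hvel : ∀ s ∈ Set.Ioo (-2 : ℝ) 2, (expGroup hX hk).velocity c s = v s := fun s hs => by
    rw [(expGroup_hasFrame hX hk).velocity_eq (h.geodesic s hs).1, (h.geodesic s hs).2.1.deriv,
      ContinuousLinearEquiv.symm_apply_apply]
  have hv0 : (expGroup hX hk).velocity c 0 = t := by rw [hvel 0 (by norm_num), h.vel]
  have h1m : (1 : ℝ) ∈ Set.Ioo (-1) b := ⟨by norm_num, hb1⟩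
  refine ⟨c, -1, b, ⟨by norm_num, by linarith, ?_, h.base, ?_, ?_, ?_⟩, h1m, ?_, hv0, ?_⟩
  · have h3 : ContDiff ℝ ∞ (fun s : ℝ => (x, s • t)) :=
      contDiff_const.prodMk (contDiff_id.smul contDiff_const)
    have h4 := (contDiffOn_frameExp hX hk).comp h3.contDiffOn hmem
    exact (contDiff_fst.comp_contDiffOn h4).congr fun s hs => by
      rw [← hact s hs, expGroup_act]; rfl
  · intro s hs
    rw [hv0]; exact hmem s hs
  · intro s hs
    rw [hv0]; exact hact s hs
  · intro s s' hs hs' hd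
    rw [hv0, hvel s (hsub hs)] at hd ⊢
    have hadd : ((expGroup hX hk).K x (s • t)
        + (expGroup hX hk).K ((expGroup hX hk).act x (s • t)) (s' • v s))
        = (expGroup hX hk).K x ((s + s') • t) := by
      have hA : (B s).comp ((expGroup hX hk).rotL x (s • t)) = 1 := by
        have h5 := norm_frameExp_of_mem hX hk (hmem s hs)
        rw [h.frameExp_smul hX hk (hsub hs)] at h5
        ext θ
        change B s (isometryInv (frameExp X k x (s • t)).2 θ) = θ
        rw [h.frameExp_smul hX hk (hsub hs)]
        exact apply_isometryInv h5 θ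
      rw [hact s hs]
      change (frameExp X k x (s • t)).1 - x + ((frameExp X k (c s) (s' • v s)).1 - c s)
        = (frameExp X k x ((s + s') • t)).1 - x
      rw [h.frameExp_add hX hk (hsub hs) (hsub hs') hA, h.frameExp_smul hX hk (hsub hs),
        h.frameExp_smul hX hk (hsub hs')]
      simp only
      abel
    have hmul : (expGroup hX hk).mul x (s • t) (s' • v s) = (s + s') • t := by
      rw [TranslationGroup.mul, hadd, (expGroup hX hk).H_K _ _ (hmem _ hs')]
    refine Prod.ext hmul ?_
    simp only [MotionGroup.motionMul, hmul, one_mul, mul_one]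
    rw [mul_inv_eq_one, hact s hs]
    have hd2 := hd.2.1
    rw [hact s hs] at hd2
    have hBs := norm_frameExp_of_mem hX hk (hmem s hs)
    have hBs' := norm_frameExp_of_mem hX hk (hmem _ hs')
    have hBcs := norm_frameExp_of_mem hX hk hd2
    have hA : (B s).comp ((expGroup hX hk).rotL x (s • t)) = 1 := by
      ext θ
      change B s (isometryInv (frameExp X k x (s • t)).2 θ) = θ
      rw [h.frameExp_smul hX hk (hsub hs)] at hBs ⊢
      exact apply_isometryInv hBs θ
    have e1 := h.frameExp_smul hX hk (hsub hs)
    have e2 := h.frameExp_smul hX hk (hsub hs')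
    have e3 := h.frameExp_add hX hk (hsub hs) (hsub hs') hA
    have hA' : ∀ θ, (expGroup hX hk).rotL x (s • t) (B s θ) = θ := fun θ => by
      change isometryInv (frameExp X k x (s • t)).2 (B s θ) = θ
      rw [e1] at hBs ⊢
      exact isometryInv_apply hBs θ
    ext θ
    change isometryInv (frameExp X k x (s • t)).2 (isometryInv (frameExp X k (c s) (s' • v s)).2 θ)
      = isometryInv (frameExp X k x ((s + s') • t)).2 θ
    -- With `θ` written as a transported vector, both sides return `ψ`: the left one passes through
    -- `B s ψ` at `c s`.
    obtain ⟨ψ, rfl⟩ : ∃ ψ, B (s + s') ψ = θ := by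
      rw [e2] at hBs'
      exact ⟨_, apply_isometryInv hBs' θ⟩
    rw [e1] at hBs
    rw [e2] at hBs'
    rw [e3] at hBcs
    rw [e1, e2, e3, isometryInv_apply hBs']
    have h6 : B (s + s') ψ
        = ((B (s + s')).comp ((expGroup hX hk).rotL x (s • t))) (B s ψ) := by
      rw [ContinuousLinearMap.comp_apply, hA']
    rw [h6, isometryInv_apply hBcs, isometryInv_apply hBs]
  · have h3 := hact 1 h1m
    rw [one_smul] at h3
    exact h3.symm
  · have h3 := (h.geodesic 0 (by norm_num)).2.2
    rw [h.base, h.vel] at h3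
    refine h3.congr_of_eventuallyEq ?_
    filter_upwards [Ioo_mem_nhds (show (-2 : ℝ) < 0 by norm_num) (show (0 : ℝ) < 2 by norm_num)]
      with s hs
    exact hvel s hs

end ExponentialGroup

/-! ### The connection of the exponential group, and existence -/

section Existence

variable {V : Type*} [NormedAddCommGroup V] [NormedSpace ℝ V] [FiniteDimensional ℝ V]
variable {T : Type*} [NormedAddCommGroup T] [InnerProductSpace ℝ T] [FiniteDimensional ℝ T]
variable {X : Set V} {k : V → T ≃L[ℝ] V}

theorem TranslationGroup.gamma_add_add {G : TranslationGroup X T} (hG : G.HasFrame k)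
    (hX : IsOpen X) (hk : ContDiffOn ℝ ∞ (fun x => (k x : T →L[ℝ] V)) X) {x : V} (hx : x ∈ X)
    (l l' : T) : G.gamma x (l + l') (l + l') =
      G.gamma x l l + G.gamma x l l' + G.gamma x l' l + G.gamma x l' l' := by
  apply (k x).injective
  simp only [map_add, frame_gamma hG hX hk hx, add_apply]
  abel

/-- Homogeneity extends the diagonal values to all vectors, polarization gives the symmetric part,
and the antisymmetric part is the anholonomity for both connections. -/
theorem TranslationGroup.gamma_eq_of_gamma_self_eq {G : TranslationGroup X T} (hG : G.HasFrame k)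
    (hX : IsOpen X) (hk : ContDiffOn ℝ ∞ (fun x => (k x : T →L[ℝ] V)) X) {x : V} (hx : x ∈ X)
    (h : ∀ᶠ l in nhds 0, G.gamma x l l = leviCivita k x l l) (l l' : T) :
    G.gamma x l l' = leviCivita k x l l' := by
  have hself : ∀ l, G.gamma x l l = leviCivita k x l l := by
    intro l
    have h4 : ContinuousAt (fun a : ℝ => a • l) 0 := by fun_prop
    have h5 : ∀ᶠ a in nhds (0 : ℝ), G.gamma x (a • l) (a • l) = leviCivita k x (a • l) (a • l) :=
      h4.eventually (p := fun l => G.gamma x l l = leviCivita k x l l)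
        (by beta_reduce; rwa [zero_smul])
    have h6 : ∀ᶠ a in nhdsWithin (0 : ℝ) (Set.Ioi 0), a ≠ 0 :=
      Filter.mem_of_superset self_mem_nhdsWithin fun a ha => ne_of_gt ha
    obtain ⟨a, ha, ha0⟩ := ((h5.filter_mono nhdsWithin_le_nhds).and h6).exists
    rw [gamma_smul_smul hG hX hk hx] at ha
    simp only [map_smul, smul_apply, smul_smul] at ha
    exact smul_right_injective T (mul_ne_zero ha0 ha0) ha
  have h1 := gamma_torsion hG hX hk hx l l'
  have h2 := (isLeviCivita_leviCivita X k).torsion hx l l'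
  have h3 := hself (l + l')
  rw [gamma_add_add hG hX hk hx, hself l, hself l'] at h3
  simp only [map_add, add_apply] at h3
  have h4 : (2 : ℝ) • G.gamma x l l' = (2 : ℝ) • leviCivita k x l l' := by
    have h5 : G.gamma x l l' + G.gamma x l' l = leviCivita k x l l' + leviCivita k x l' l := by
      have h6 := congrArg (fun w => w - leviCivita k x l l - leviCivita k x l' l') h3
      beta_reduce at h6
      convert h6 using 1 <;> abel
    have h7 : G.gamma x l l' - G.gamma x l' l = leviCivita k x l l' - leviCivita k x l' l :=
      h1.trans h2.symm
    rw [two_smul, two_smul]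
    calc _ = (G.gamma x l l' + G.gamma x l' l) + (G.gamma x l l' - G.gamma x l' l) := by abel
      _ = _ := by rw [h5, h7]; abel
  exact smul_right_injective T two_ne_zero h4

/-- Canonical curves are geodesics, and skewness of the connection keeps the length of their
velocity constant. -/
theorem TranslationGroup.IsCanonical.isRiemannian {G : TranslationGroup X T}
    (hcan : G.IsCanonical) (hG : G.HasFrame k) (hX : IsOpen X)
    (hk : ContDiffOn ℝ ∞ (fun x => (k x : T →L[ℝ] V)) X)
    (hγ : ∀ x ∈ X, ∀ l l' : T, G.gamma x l l' = leviCivita k x l l') : G.IsRiemannian := by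
  refine ⟨hcan, fun x c a b _ hc s hs => ?_⟩
  have hg := hc.isGeodesicOn hG hX hk hγ
  have hd : ∀ s ∈ Set.Ioo a b,
      HasDerivAt (fun s => inner ℝ (G.velocity c s) (G.velocity c s)) 0 s := by
    intro s hs
    have h := (hg s hs).2.2.inner ℝ (hg s hs).2.2
    simpa [inner_neg_left, inner_neg_right, leviCivita_skew, real_inner_comm (G.velocity c s)
      (leviCivita k (c s) (G.velocity c s) (G.velocity c s))] using h
  exact isOpen_Ioo.is_const_of_deriv_eq_zero isPreconnected_Ioo
    (fun s hs => (hd s hs).differentiableAt.differentiableWithinAt)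
    (fun s hs => (hd s hs).deriv) hs ⟨hc.neg, hc.pos⟩

/-- At time `0` the velocity of a canonical curve has derivative `-γ(t, t)` by canonicity and minus
the Levi-Civita term by the geodesic equation; so the two connections agree on the diagonal for
small `t`. -/
theorem expGroup_gamma (hX : IsOpen X) (hk : ContDiffOn ℝ ∞ (fun x => (k x : T →L[ℝ] V)) X) :
    ∀ x ∈ X, ∀ l l' : T, (expGroup hX hk).gamma x l l' = leviCivita k x l l' := by
  intro x hx
  have h0 : (x, (0 : T)) ∈ (expGroup hX hk).dom := zero_mem_expDom hX hk hx
  refine TranslationGroup.gamma_eq_of_gamma_self_eq (expGroup_hasFrame hX hk) hX hk hx ?_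
  filter_upwards [TranslationGroup.eventually_mem_dom h0] with l hl
  obtain ⟨c, a, b, hc, -, -, hv, hd⟩ := expGroup_exists_canonicalCurve hX hk hl
  have h1 := hc.toTranslationGroup.hasDerivAt_velocity (expGroup_hasFrame hX hk) hX hk
    ⟨hc.neg, hc.pos⟩
  have h2 := h1.unique hd
  rw [hv, hc.start] at h2
  exact neg_injective h2

/-- The translation part serves as its own base group, so the conditions on the frame and on the
base connection hold by reflexivity. -/
theorem expGroup_isParallelTransport (hX : IsOpen X)
    (hk : ContDiffOn ℝ ∞ (fun x => (k x : T →L[ℝ] V)) X) :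
    MotionGroup.IsParallelTransport (expGroup hX hk).toTranslationGroup (expGroup hX hk) := by
  refine ⟨⟨fun _ _ => rfl, fun x hx l θ => ?_⟩, fun _ _ _ _ => rfl, fun x x' hx' => ?_⟩
  · rw [expGroup_fderiv_rotL hX hk hx, expGroup_gamma hX hk x hx]
  · obtain ⟨⟨y, t⟩, ht, he⟩ := id hx'
    obtain ⟨rfl, h1⟩ := Prod.ext_iff.1 he
    obtain ⟨c, a, b, hc, h1m, hc1, -, -⟩ := expGroup_exists_canonicalCurve hX hk ht
    refine ⟨c, a, b, 1, hc, h1m, ?_⟩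
    rw [hc1]
    have h2 : expMap X k y t = x' - y := h1
    change y + expMap X k y t = x'
    rw [h2, add_sub_cancel]

end Existence

theorem proposition4
    {V : Type*} [NormedAddCommGroup V] [NormedSpace ℝ V] [FiniteDimensional ℝ V]
    {T : Type*} [NormedAddCommGroup T] [InnerProductSpace ℝ T] [FiniteDimensional ℝ T]
    (X : Set V) (hX : IsOpen X)
    (k : V → T ≃L[ℝ] V) (hk : ContDiffOn ℝ ∞ (fun x => (k x : T →L[ℝ] V)) X) :
    (∃ (R : TranslationGroup X T) (P : MotionGroup X T),
      R.IsRiemannian ∧ R.HasFrame k ∧ MotionGroup.IsParallelTransport R P) ∧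
    (∀ (R R' : TranslationGroup X T) (P P' : MotionGroup X T),
      R.IsRiemannian → R.HasFrame k → MotionGroup.IsParallelTransport R P →
      R'.IsRiemannian → R'.HasFrame k → MotionGroup.IsParallelTransport R' P' →
      P.Coincide P') ∧
    (∀ (R : TranslationGroup X T) (P : MotionGroup X T),
      R.IsRiemannian → R.HasFrame k → MotionGroup.IsParallelTransport R P →
      P.toTranslationGroup.Coincide R ∧
      IsLeviCivita X k R.gamma ∧
      (∀ (x : V) (t : T), (x, t) ∈ P.dom →
        ∃ τ : ℝ → T, τ 0 = t ∧
          (∀ s ∈ Set.Icc (0 : ℝ) 1, (x, s • t) ∈ P.dom ∧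
            HasDerivAt (fun σ : ℝ => P.act x (σ • t)) (k (P.act x (s • t)) (τ s)) s ∧
            HasDerivAt τ (-R.gamma (P.act x (s • t)) (τ s) (τ s)) s) ∧
          ∀ θ : ℝ → T,
            (∀ s ∈ Set.Icc (0 : ℝ) 1, HasDerivWithinAt θ
              (-R.gamma (P.act x (s • t)) (τ s) (θ s)) (Set.Icc 0 1) s) ↔
            (∀ s ∈ Set.Icc (0 : ℝ) 1, P.rot x (s • t) (θ s) = θ 0)) ∧
      (∀ x ∈ X, ∀ ϖ : T → T →L[ℝ] T, DifferentiableOn ℝ ϖ {t | (x, t) ∈ P.dom} →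
        ((ϖ 0 = 1 ∧ ∀ t, (x, t) ∈ P.dom → P.TransportEq R x ϖ t) ↔
          ∀ t, (x, t) ∈ P.dom → ϖ t = P.rotL x t))) := by
  refine ⟨?_, ?_, ?_⟩
  · have hP := expGroup_isParallelTransport hX hk
    have hF := expGroup_hasFrame hX hk
    exact ⟨(expGroup hX hk).toTranslationGroup, expGroup hX hk,
      hP.isCanonical.isRiemannian hF hX hk (expGroup_gamma hX hk), hF, hP⟩
  · intro R R' P P' _ hRF hP _ hRF' hP'
    exact hP.coincide hRF hP' hRF' hX hk
  · intro R P hR hRF hP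
    exact ⟨hP.coincide_base hRF hR.canonical hX hk, hP.motion.isLeviCivita hRF hX hk,
      fun x t ht => hP.exists_parallel hRF hX hk ht,
      fun x hx ϖ hϖ => hP.transportEq_iff_eq hRF hX hk hx hϖ⟩
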